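/- Let $n\ge 2$, let $T^{2n}=\mathbb{R}^{2n}/\mathbb{Z}^{2n}$ with angle variables $x^a$ and invariant vector fields $\partial_a$, and let $\omega$ be a $T^{2n}$-invariant symplectic form on $T^{2n}$. Let $\nabla^0$ be the standard flat connection, $\nabla^0_{\partial_a}\partial_b=0$. A formal curve of symplectic connections is a formal power series $\nabla^t=\nabla+\sum_{k\ge1}t^kA^{(k)}$, where $\nabla$ is a symplectic connection on $(T^{2n},\omega)$ (torsion free, $\nabla\omega=0$) and the $A^{(k)}$ are smooth $(2,1)$-tensors such that $\omega(A^{(k)}(X)Y,Z)$ is totally symmetric. Its formal curvature is $R^t(X,Y)Z=\nabla^t_X\nabla^t_YZ-\nabla^t_Y\nabla^t_XZ-\nabla^t_{[X,Y]}Z$, its formal Ricci tensor is $r^t(X,Y)=\operatorname{Trace}[Z\mapsto R^t(X,Z)Y]$, and $W^t=R^t-E^t$ where $R^t(X,Y;Z,T)=\omega(R^t(X,Y)Z,T)$ and $$E^t(X,Y;Z,T)=\frac{-1}{2(n+1)}\bigl[2\omega(X,Y)r^t(Z,T)+\omega(X,Z)r^t(Y,T)+\omega(X,T)r^t(Y,Z)-\omega(Y,Z)r^t(X,T)-\omega(Y,T)r^t(X,Z)\bigr].$$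 The curve is of Ricci type if $W^t=0$, and flat if $R^t=0$ (both to all orders in $t$). A formal curve of symplectomorphisms is a homomorphism of Poisson algebras $\psi_t=\sum_{k\ge0}t^k\psi^{(k)}\colon C^\infty(T^{2n})\to C^\infty(T^{2n})[[t]]$ whose leading term $\psi^{(0)}\colon C^\infty(T^{2n})\to C^\infty(T^{2n})$ is an isomorphism; it is extended $\mathbb{R}[[t]]$-linearly ($t$-adically) to $C^\infty(T^{2n})[[t]]$. It acts on formal curves of vector fields by $(\psi_t\cdot X)f=\psi_t(X(\psi_t^{-1}f))$ and on formal curves of connections by $(\psi_t\cdot\nabla^t)_XY=\psi_t\cdot(\nabla^t_{\psi_t^{-1}\cdot X}\,\psi_t^{-1}\cdot Y)$. **Theorem.** Let $\nabla^t$ be a formal curve of symplectic connections on $(T^{2n},\omega)$ whose term of order zero is $\nabla^0$ and with $W^t=0$. Then there is a formal curve of symplectomorphisms $\psi_t$ such that $\widetilde\nabla^t:=\psi_t\cdot\nabla^t$ is a formal curve of symplectic connections which is $T^{2n}$-invariant, is of Ricci type, and is flat. In particular the formal curvature $R^t$ of $\nabla^t$ vanishes. -/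

import Mathlib

open scoped BigOperators

noncomputable section

namespace FormalTorus

/-- The torus `T^{2n} = ℝ^{2n} / ℤ^{2n}`. -/
abbrev Torus (n : ℕ) : Type := UnitAddTorus (Fin (2 * n))

/-- The quotient map `ℝ^{2n} → T^{2n}`. -/
def proj (n : ℕ) (y : Fin (2 * n) → ℝ) : Torus n := fun i => (y i : UnitAddCircle)

/-- The algebra `C^∞(T^{2n})` of smooth real functions on the torus: a function on the quotient
is smooth exactly when its pull-back to `ℝ^{2n}` is. -/
def smoothFunctions (n : ℕ) : Subalgebra ℝ (Torus n → ℝ) where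
  carrier := {f | ContDiff ℝ (⊤ : ℕ∞) (f ∘ proj n)}
  mul_mem' := fun {_ _} hf hg => by
    rw [Set.mem_ofPred_eq] at *
    exact hf.mul hg
  add_mem' := fun {_ _} hf hg => by
    rw [Set.mem_ofPred_eq] at *
    exact hf.add hg
  algebraMap_mem' := fun r => by
    rw [Set.mem_ofPred_eq]
    exact contDiff_const (c := r)

/-- `C^∞(T^{2n})` as a commutative `ℝ`-algebra. -/
abbrev Fn (n : ℕ) : Type := smoothFunctions n

/-- `C^∞(T^{2n})[[t]]`, the formal curves of functions. -/
abbrev FormalFn (n : ℕ) : Type := PowerSeries (Fn n)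

/-- The derivative of a function on the torus along the `a`-th standard angle variable. -/
def angleDeriv {n : ℕ} (a : Fin (2 * n)) (f : Torus n → ℝ) (x : Torus n) : ℝ :=
  deriv (fun s : ℝ => f (x + proj n (Pi.single a s))) 0

theorem proj_add {n : ℕ} (y z : Fin (2 * n) → ℝ) : proj n (y + z) = proj n y + proj n z := by
  funext i
  simp [proj]

theorem angleDeriv_comp_proj {n : ℕ} (a : Fin (2 * n)) {f : Torus n → ℝ}
    (hf : ContDiff ℝ (⊤ : ℕ∞) (f ∘ proj n)) :
    angleDeriv a f ∘ proj n = fun y => fderiv ℝ (f ∘ proj n) y (Pi.single a 1) := by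
  funext y
  have hd : HasFDerivAt (f ∘ proj n) (fderiv ℝ (f ∘ proj n) y) (y + (0 : ℝ) • Pi.single a 1) := by
    simpa using ((hf.differentiable (by simp)) y).hasFDerivAt
  have hline : HasDerivAt (fun s : ℝ => y + s • (Pi.single a 1 : Fin (2 * n) → ℝ))
      (Pi.single a 1) 0 := by
    simpa using ((hasDerivAt_id (0 : ℝ)).smul_const
      (Pi.single a 1 : Fin (2 * n) → ℝ)).const_add y
  have h := hd.comp_hasDerivAt (0 : ℝ) hline
  rw [← h.deriv]
  simp only [Function.comp_apply, angleDeriv]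
  congr 1
  funext s
  simp only [Function.comp_apply, proj_add]
  congr 3
  rw [← Pi.single_smul]
  simp

/-- The invariant vector field `∂_a` on the torus, acting on smooth functions. -/
def pd {n : ℕ} (a : Fin (2 * n)) (f : Fn n) : Fn n :=
  ⟨angleDeriv a f.1, by
    change ContDiff ℝ (⊤ : ℕ∞) (angleDeriv a f.1 ∘ proj n)
    rw [angleDeriv_comp_proj a f.2]
    have hf : ContDiff ℝ (⊤ : ℕ∞) (f.1 ∘ proj n) := f.2
    exact (hf.fderiv_right (m := (⊤ : ℕ∞)) (by simp)).clm_apply contDiff_const⟩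

/-- The action `f ↦ f(· + v)` of the torus on its smooth functions. -/
def translate {n : ℕ} (v : Torus n) (f : Fn n) : Fn n :=
  ⟨fun x => f.1 (x + v), by
    change ContDiff ℝ (⊤ : ℕ∞) ((fun x => f.1 (x + v)) ∘ proj n)
    obtain ⟨w, hw⟩ : ∃ w, proj n w = v :=
      ⟨fun i => (QuotientAddGroup.mk_surjective (v i)).choose,
        funext fun i => (QuotientAddGroup.mk_surjective (v i)).choose_spec⟩
    have : (fun x => f.1 (x + v)) ∘ proj n = fun y => (f.1 ∘ proj n) (y + w) := by
      funext y
      simp [proj_add, hw]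
    rw [this]
    exact ContDiff.comp (g := f.1 ∘ proj n) f.2 (contDiff_id.add contDiff_const)⟩

/-- `∂_a` extended coefficientwise to formal curves of functions. -/
def fpd {n : ℕ} (a : Fin (2 * n)) (f : FormalFn n) : FormalFn n :=
  PowerSeries.mk fun k => pd a (PowerSeries.coeff k f)

/-- Translation extended coefficientwise to formal curves of functions. -/
def ftranslate {n : ℕ} (v : Torus n) (f : FormalFn n) : FormalFn n :=
  PowerSeries.mk fun k => translate v (PowerSeries.coeff k f)

/-- Formal curves of vector fields `X_t = ∑_a X_t^a ∂_a` on the torus, given by their components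
in the global frame `∂_a`. -/
abbrev FormalVF (n : ℕ) : Type := Fin (2 * n) → FormalFn n

namespace FormalVF

variable {n : ℕ}

/-- The (constant) frame field `∂_a`. -/
def frame (a : Fin (2 * n)) : FormalVF n := Pi.single a 1

/-- A formal curve of vector fields as a derivation of `C^∞(T^{2n})[[t]]`. -/
def act (X : FormalVF n) (f : FormalFn n) : FormalFn n := ∑ a, X a * fpd a f

/-- The Lie bracket `[X, Y]`. -/
def bracket (X Y : FormalVF n) : FormalVF n := fun c => act X (Y c) - act Y (X c)

/-- Translation of vector fields; the frame `∂_a` is translation invariant. -/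
def translate (v : Torus n) (X : FormalVF n) : FormalVF n := fun a => ftranslate v (X a)

end FormalVF

/-- A `T^{2n}`-invariant symplectic form `ω = ½ ∑ ω_{ab} dx^a ∧ dx^b`: its components
`ω_{ab} = ω(∂_a, ∂_b)` are constants (so that it is closed), skew and nondegenerate. -/
structure InvariantSymplecticForm (n : ℕ) where
  mat : Matrix (Fin (2 * n)) (Fin (2 * n)) ℝ
  skew : ∀ a b, mat a b = -mat b a
  nondegenerate : IsUnit mat.det

namespace InvariantSymplecticForm

variable {n : ℕ} (ω : InvariantSymplecticForm n)

/-- `ω(X, Y)` for formal curves of vector fields. -/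
def app (X Y : FormalVF n) : FormalFn n := ∑ a, ∑ b, ω.mat a b • (X a * Y b)

/-- The Hamiltonian vector field `X_f`, the solution of `i(X_f) ω = df`, that is
`∑_a X_f^a ω_{ab} = ∂_b f`. -/
def hamiltonian (f : FormalFn n) : FormalVF n := fun a => ∑ b, ω.mat⁻¹ b a • fpd b f

/-- The Poisson bracket `{f, g} = X_f g` of formal curves of functions. -/
def fpoisson (f g : FormalFn n) : FormalFn n := (ω.hamiltonian f).act g

/-- The Poisson bracket `{f, g} = X_f g` of functions on the torus. -/
def poisson (f g : Fn n) : Fn n := ∑ a, (∑ b, ω.mat⁻¹ b a • pd b f) * pd a g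

end InvariantSymplecticForm

/-- A formal curve of linear connections `∇^t = ∇^0 + ∑_{k ≥ 0} t^k A^{(k)}` on the torus, where
`∇^0` is the standard flat connection (`∇^0_{∂_a} ∂_b = 0`) and the `A^{(k)}` are arbitrary
`(2,1)` tensor fields: `coef a b c` is the series `∑_k t^k (A^{(k)})^c_{ab}`, the component on
`∂_c` of `∇^t_{∂_a} ∂_b`. -/
structure FormalConnection (n : ℕ) where
  coef : Fin (2 * n) → Fin (2 * n) → Fin (2 * n) → FormalFn n

namespace FormalConnection

variable {n : ℕ} (D : FormalConnection n)

/-- The covariant derivative `∇^t_X Y`. -/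
def cov (X Y : FormalVF n) : FormalVF n :=
  fun c => X.act (Y c) + ∑ a, ∑ b, X a * Y b * D.coef a b c

/-- The term of order zero of `∇^t` is the standard flat connection. -/
def StartsAtStandard : Prop := ∀ a b c, PowerSeries.coeff 0 (D.coef a b c) = 0

/-- `∇^t` is a formal curve of symplectic connections: it is torsion free and `∇^t ω = 0`. -/
structure IsSymplectic (ω : InvariantSymplecticForm n) : Prop where
  torsion_free : ∀ X Y : FormalVF n, D.cov X Y - D.cov Y X = X.bracket Y
  parallel : ∀ X Y Z : FormalVF n,
    X.act (ω.app Y Z) = ω.app (D.cov X Y) Z + ω.app Y (D.cov X Z)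

/-- The formal curvature endomorphism `R^t(X, Y) Z`. -/
def curv (X Y Z : FormalVF n) : FormalVF n :=
  D.cov X (D.cov Y Z) - D.cov Y (D.cov X Z) - D.cov (X.bracket Y) Z

/-- The formal curvature vanishes (to all orders in `t`). -/
def IsFlat : Prop := ∀ X Y Z : FormalVF n, D.curv X Y Z = 0

/-- The formal Ricci tensor `r^t(X, Y) = Trace [Z ↦ R^t(X, Z) Y]`. -/
def ricci (X Y : FormalVF n) : FormalFn n := ∑ c, D.curv X (FormalVF.frame c) Y c

/-- The Ricci part `E^t(X, Y; Z, T)` of the formal curvature tensor. -/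
def ricciPart (ω : InvariantSymplecticForm n) (X Y Z T : FormalVF n) : FormalFn n :=
  (-1 / (2 * ((n : ℝ) + 1))) •
    (2 * ω.app X Y * D.ricci Z T + ω.app X Z * D.ricci Y T + ω.app X T * D.ricci Y Z
      - ω.app Y Z * D.ricci X T - ω.app Y T * D.ricci X Z)

/-- The `W` part `W^t(X, Y; Z, T) = ω(R^t(X, Y) Z, T) - E^t(X, Y; Z, T)` of the curvature. -/
def weylPart (ω : InvariantSymplecticForm n) (X Y Z T : FormalVF n) : FormalFn n :=
  ω.app (D.curv X Y Z) T - D.ricciPart ω X Y Z T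

/-- The formal curvature is of Ricci type: `W^t = 0`. -/
def IsRicciType (ω : InvariantSymplecticForm n) : Prop :=
  ∀ X Y Z T : FormalVF n, D.weylPart ω X Y Z T = 0

/-- `∇^t` is invariant under all translations of the torus. -/
def IsInvariant : Prop :=
  ∀ (v : Torus n) (X Y : FormalVF n),
    D.cov (X.translate v) (Y.translate v) = (D.cov X Y).translate v

end FormalConnection

/-- A formal curve of symplectomorphisms: a homomorphism of Poisson algebras
`ψ_t : C^∞(T^{2n}) → C^∞(T^{2n})[[t]]` whose leading term is an isomorphism. -/
structure FormalSymplecto {n : ℕ} (ω : InvariantSymplecticForm n) where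
  hom : Fn n →ₐ[ℝ] FormalFn n
  map_poisson : ∀ f g : Fn n, hom (ω.poisson f g) = ω.fpoisson (hom f) (hom g)
  leading_bijective : Function.Bijective fun f : Fn n => PowerSeries.coeff 0 (hom f)

namespace FormalSymplecto

variable {n : ℕ} {ω : InvariantSymplecticForm n} (ψ : FormalSymplecto ω)

/-- The `ℝ[[t]]`-linear extension of `ψ_t` to `C^∞(T^{2n})[[t]]`, an automorphism of
`C^∞(T^{2n})[[t]]`: `∑ t^i f_i ↦ ∑ t^i ψ_t(f_i)`. -/
def ext (f : FormalFn n) : FormalFn n :=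
  PowerSeries.mk fun m =>
    ∑ p ∈ Finset.HasAntidiagonal.antidiagonal m, PowerSeries.coeff p.2 (ψ.hom (PowerSeries.coeff p.1 f))

/-- `X' = ψ_t · X`, that is `X' f = ψ_t (X (ψ_t⁻¹ f))` for all `f`; here `f` is written
as `ψ_t g`. -/
def Push (X X' : FormalVF n) : Prop := ∀ g : FormalFn n, X'.act (ψ.ext g) = ψ.ext (X.act g)

/-- `D' = ψ_t · D`, that is `D'_{X'} Y' = ψ_t · (D_{ψ_t⁻¹ · X'} (ψ_t⁻¹ · Y'))` for all `X'`, `Y'`;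
here `X = ψ_t⁻¹ · X'` and `Y = ψ_t⁻¹ · Y'`. -/
def Transforms (D D' : FormalConnection n) : Prop :=
  ∀ X' Y' : FormalVF n, ∃ X Y : FormalVF n,
    ψ.Push X X' ∧ ψ.Push Y Y' ∧ ψ.Push (D.cov X Y) (D'.cov X' Y')

end FormalSymplecto

end FormalTorus

end

/-! Formal Hamiltonian flows act on formal curves of connections. Such a flow is built, order by
order, so that the transformed curve has constant coefficients; a constant connection of Ricci type
is then flat by pure algebra, and flatness passes back because curvature is natural.

Normalisation. Suppose the coefficients are constant below order `k`, and let `α` be the order-`k`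
coefficient with its last index lowered by `ω`, a totally symmetric tensor. As the curve starts at
the flat connection, the quadratic part of the curvature at order `k` involves lower orders only and
is constant. So `∂_a α_{bcd} - ∂_b α_{acd}` plus a constant has the Ricci shape `ricciForm` for some
`s`. Differentiating yields a Bianchi identity for `∂s`, whose traces force `∂_e s_{cd} = ω_{ec} u_d
+ ω_{ed} u_c` (`exists_eq_of_bianchi`, where `n ≥ 2` is essential). Commuting derivatives gives `∂_e
u_d = ω_{ed} τ` with `τ` constant. On the torus every derivative has mean zero, so a function with
constant derivatives is constant: `u` and then `s` are constant. The curl of `α` is then constant of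
mean zero, hence zero, and integrating closed forms three times gives `α = ∂³f + const`
(`exists_third_derivative_of_linear`). Adding `-t^k f` to the Hamiltonian removes exactly `∂³f` at
order `k` (`gaugeConn_add_sub_mem`), and the corrections converge `t`-adically
(`exists_gaugeConn_const`).

Constant coefficients (`ricci_eq_zero_of_const`), over the domain `ℝ[[t]]`. The Bianchi identity
again expresses `∇s` by a covector `u`. The Ricci identity for `s` says that `s ω⁻¹ s`, which is
skew, and `∇u`, which is symmetric, agree up to sign and a multiple of `ω`; hence `∇u = 0`. A vector
that contracts the connection coefficients to zero also contracts the curvature to zero, and for a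
curvature of Ricci type this forces the vector or `s` to vanish. Applied to the dual of `u`, and
then to the columns of `ω⁻¹ s`, this gives `s = 0`. -/

noncomputable section

namespace FormalTorus

/-! ### Calculus on the torus: mean values and closed 1-forms -/

section Calculus

variable {n : ℕ}

theorem proj_surjective (n : ℕ) : Function.Surjective (proj n) := fun v =>
  ⟨fun i => (QuotientAddGroup.mk_surjective (v i)).choose,
    funext fun i => (QuotientAddGroup.mk_surjective (v i)).choose_spec⟩

/-- The pull-back of a smooth function to `ℝ^{2n}`. -/
def lift (f : Fn n) : (Fin (2 * n) → ℝ) → ℝ := f.1 ∘ proj n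

theorem lift_contDiff (f : Fn n) : ContDiff ℝ (⊤ : ℕ∞) (lift f) := f.2

theorem lift_differentiable (f : Fn n) : Differentiable ℝ (lift f) :=
  (lift_contDiff f).differentiable (by simp)

theorem lift_injective : Function.Injective (lift (n := n)) := by
  intro f g h
  apply Subtype.ext
  funext x
  obtain ⟨y, rfl⟩ := proj_surjective n x
  exact congrFun h y

theorem lift_pd (a : Fin (2 * n)) (f : Fn n) (y : Fin (2 * n) → ℝ) :
    lift (pd a f) y = fderiv ℝ (lift f) y (Pi.single a 1) :=
  congrFun (angleDeriv_comp_proj a f.2) y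

theorem lift_add (f g : Fn n) : lift (f + g) = lift f + lift g := rfl
theorem lift_mul (f g : Fn n) : lift (f * g) = lift f * lift g := rfl
theorem lift_smul (r : ℝ) (f : Fn n) : lift (r • f) = r • lift f := rfl
theorem lift_algebraMap (r : ℝ) : lift (algebraMap ℝ (Fn n) r) = fun _ => r := rfl

theorem pd_add (a : Fin (2 * n)) (f g : Fn n) : pd a (f + g) = pd a f + pd a g := by
  apply lift_injective
  funext y
  rw [lift_add, Pi.add_apply, lift_pd, lift_pd, lift_pd, lift_add,
    fderiv_add (lift_differentiable f y) (lift_differentiable g y)]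
  rfl

theorem pd_smul (a : Fin (2 * n)) (r : ℝ) (f : Fn n) : pd a (r • f) = r • pd a f := by
  apply lift_injective
  funext y
  rw [lift_smul, Pi.smul_apply, lift_pd, lift_pd, lift_smul,
    fderiv_const_smul (lift_differentiable f y)]
  rfl

theorem pd_mul (a : Fin (2 * n)) (f g : Fn n) : pd a (f * g) = pd a f * g + f * pd a g := by
  apply lift_injective
  funext y
  rw [lift_add, lift_mul, lift_mul, Pi.add_apply, Pi.mul_apply, Pi.mul_apply, lift_pd, lift_pd,
    lift_pd, lift_mul, fderiv_mul (lift_differentiable f y) (lift_differentiable g y)]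
  simp
  ring

theorem pd_algebraMap (a : Fin (2 * n)) (r : ℝ) : pd a (algebraMap ℝ (Fn n) r) = 0 := by
  apply lift_injective
  funext y
  rw [lift_pd, lift_algebraMap]
  simp [lift]

theorem pd_comm (a b : Fin (2 * n)) (f : Fn n) : pd a (pd b f) = pd b (pd a f) := by
  have key : ∀ (a b : Fin (2 * n)) y, lift (pd a (pd b f)) y
      = fderiv ℝ (fderiv ℝ (lift f)) y (Pi.single a 1) (Pi.single b 1) := by
    intro a b y
    rw [lift_pd, show lift (pd b f) = fun y => fderiv ℝ (lift f) y (Pi.single b 1) from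
      funext fun y => lift_pd b f y]
    have h : DifferentiableAt ℝ (fderiv ℝ (lift f)) y :=
      (((lift_contDiff f).fderiv_right (m := 1) (by norm_cast)).differentiable (by simp)) y
    rw [fderiv_clm_apply h (differentiableAt_const _)]
    simp
  apply lift_injective
  funext y
  rw [key, key]
  have : IsSymmSndFDerivAt ℝ (lift f) y :=
    (lift_contDiff f).contDiffAt.isSymmSndFDerivAt (by
      rw [minSmoothness_of_isRCLikeNormedField]; exact WithTop.coe_le_coe.2 le_top)
  exact this _ _

/-- The `ℝ`-linear map underlying `∂_a`. -/
def pdₗ (a : Fin (2 * n)) : Fn n →ₗ[ℝ] Fn n where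
  toFun := pd a
  map_add' := pd_add a
  map_smul' := pd_smul a

theorem pdₗ_apply (a : Fin (2 * n)) (f : Fn n) : pdₗ a f = pd a f := rfl

theorem fn_const_of_pd_eq_zero {g : Fn n} (h : ∀ a, pd a g = 0) :
    ∃ r : ℝ, g = algebraMap ℝ (Fn n) r := by
  refine ⟨lift g 0, lift_injective ?_⟩
  rw [lift_algebraMap]
  funext y
  refine is_const_of_fderiv_eq_zero (lift_differentiable g) (fun z => ?_) y 0
  refine ContinuousLinearMap.coe_injective (LinearMap.pi_ext' fun a => ?_)
  ext
  have := congrFun (congrArg lift (h a)) z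
  rw [lift_pd] at this
  simpa using (this.trans rfl : _ = (0 : ℝ))

/-- Smoothness is defined on the cover; continuity descends because the projection is an open
quotient map. -/
theorem fn_continuous (f : Fn n) : Continuous f.1 := by
  have hq : Topology.IsQuotientMap (proj n) := by
    refine IsOpenQuotientMap.isQuotientMap ⟨proj_surjective n, ?_, ?_⟩
    · exact continuous_pi fun i => (AddCircle.continuous_mk' 1).comp (continuous_apply i)
    · exact IsOpenMap.piMap (fun i => QuotientAddGroup.isOpenMap_coe)
        (Filter.Eventually.of_forall fun i => QuotientAddGroup.mk_surjective)
  exact hq.continuous_iff.2 (lift_contDiff f).continuous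

open MeasureTheory in
/-- The mean value of a smooth function on the torus. -/
def mean : Fn n →ₗ[ℝ] ℝ where
  toFun f := ∫ x, f.1 x
  map_add' f g := by
    have h : ∀ f : Fn n, Integrable f.1 := fun f =>
      (fn_continuous f).integrable_of_hasCompactSupport (HasCompactSupport.of_compactSpace _)
    exact integral_add (h f) (h g)
  map_smul' r f := integral_const_mul r f.1

theorem mean_algebraMap (r : ℝ) : mean (algebraMap ℝ (Fn n) r) = r := by
  change ∫ _ : Torus n, r = r
  have : MeasureTheory.IsProbabilityMeasure (MeasureTheory.volume : MeasureTheory.Measure (Torus n)) :=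
    ⟨by rw [MeasureTheory.volume_pi, MeasureTheory.Measure.pi_univ]; simp⟩
  simp

theorem hasDerivAt_line (a : Fin (2 * n)) (f : Fn n) (x : Torus n) (s : ℝ) :
    HasDerivAt (fun s : ℝ => f.1 (x + proj n (Pi.single a s)))
      ((pd a f).1 (x + proj n (Pi.single a s))) s := by
  obtain ⟨y, rfl⟩ := proj_surjective n x
  have h1 : HasDerivAt (fun s : ℝ => y + Pi.single a s) (Pi.single a 1) s := by
    have := ((hasDerivAt_id s).smul_const (Pi.single a 1 : Fin (2 * n) → ℝ)).const_add y
    simpa [← Pi.single_smul] using this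
  have h2 := (lift_differentiable f (y + Pi.single a s)).hasFDerivAt.comp_hasDerivAt s h1
  rw [← lift_pd] at h2
  simpa [lift, Function.comp_def, proj_add] using h2

-- The mean is translation invariant, so its derivative along a line of translations is zero;
-- differentiation under the integral identifies this derivative with the mean of `pd a f`.
open MeasureTheory in
theorem mean_pd (a : Fin (2 * n)) (f : Fn n) : mean (pd a f) = 0 := by
  obtain ⟨C, hC⟩ := isCompact_univ.exists_bound_of_continuousOn
    (fn_continuous (pd a f)).continuousOn
  have hint : ∀ (f : Fn n) (v : Torus n), Integrable fun x => f.1 (x + v) := fun f v =>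
    ((fn_continuous f).comp (continuous_add_const v)).integrable_of_hasCompactSupport
      (HasCompactSupport.of_compactSpace _)
  have h := (hasDerivAt_integral_of_dominated_loc_of_deriv_le (μ := (volume : Measure (Torus n)))
    (F := fun s x => f.1 (x + proj n (Pi.single a s)))
    (F' := fun s x => (pd a f).1 (x + proj n (Pi.single a s)))
    (x₀ := 0) (s := Set.univ) (bound := fun _ => C) Filter.univ_mem
    (Filter.Eventually.of_forall fun s => (hint f _).aestronglyMeasurable) (hint f _)
    (hint (pd a f) _).aestronglyMeasurable
    (Filter.Eventually.of_forall fun x s _ => hC _ (Set.mem_univ _)) (integrable_const C)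
    (Filter.Eventually.of_forall fun x s _ => hasDerivAt_line a f x s)).2
  have hconst : (fun s : ℝ => ∫ x : Torus n, f.1 (x + proj n (Pi.single a s)))
      = fun _ => ∫ x : Torus n, f.1 x := funext fun s => integral_add_right_eq_self f.1 _
  rw [hconst, integral_add_right_eq_self (pd a f).1] at h
  exact h.unique (hasDerivAt_const _ _)

/-- Compactness enters here: a constant derivative equals its own mean, which is zero. Linear
functions are thereby excluded. -/
theorem fn_const_of_pd_const {g : Fn n} (h : ∀ a, ∃ r : ℝ, pd a g = algebraMap ℝ (Fn n) r) :
    ∃ r : ℝ, g = algebraMap ℝ (Fn n) r := by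
  refine fn_const_of_pd_eq_zero fun a => ?_
  obtain ⟨r, hr⟩ := h a
  have : r = 0 := by rw [← mean_algebraMap (n := n) r, ← hr, mean_pd]
  rw [hr, this, map_zero]

theorem pd_sub_pd_eq_zero {a b : Fin (2 * n)} {f g : Fn n} {r : ℝ}
    (h : pd a f - pd b g = algebraMap ℝ (Fn n) r) : pd a f = pd b g := by
  have : r = 0 := by rw [← mean_algebraMap (n := n) r, ← h, map_sub, mean_pd, mean_pd, sub_zero]
  rwa [this, map_zero, sub_eq_zero] at h

/-- A smooth function on `ℝ^{2n}` invariant under the unit translations, as a function on the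
torus. -/
theorem exists_lift_eq {F : (Fin (2 * n) → ℝ) → ℝ} (hF : ContDiff ℝ (⊤ : ℕ∞) F)
    (hper : ∀ y a, F (y + Pi.single a 1) = F y) : ∃ f : Fn n, lift f = F := by
  have h1 : ∀ (a : Fin (2 * n)) (k : ℤ) (y), F (y + Pi.single a (k : ℝ)) = F y := by
    intro a k
    induction k using Int.induction_on with
    | zero => simp
    | succ k ih =>
      intro y
      rw [show y + Pi.single a ((((k : ℤ) + 1 : ℤ)) : ℝ)
        = (y + Pi.single a (((k : ℤ)) : ℝ)) + Pi.single a 1 by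
        rw [add_assoc, ← Pi.single_add]; push_cast; rfl, hper, ih]
    | pred k ih =>
      intro y
      rw [← hper, show y + Pi.single a (((-(k : ℤ) - 1 : ℤ)) : ℝ) + Pi.single a 1
        = y + Pi.single a (((-(k : ℤ) : ℤ)) : ℝ) by
        rw [add_assoc, ← Pi.single_add]; push_cast; simp, ih]
  have h2 : ∀ (s : Finset (Fin (2 * n))) (k : Fin (2 * n) → ℤ) (y),
      F (y + ∑ a ∈ s, Pi.single a (k a : ℝ)) = F y := by
    intro s k
    induction s using Finset.induction_on with
    | empty => simp
    | insert a s ha ih =>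
      intro y
      rw [Finset.sum_insert ha, ← add_assoc, ih, h1]
  have h3 : ∀ y z, proj n y = proj n z → F y = F z := by
    intro y z hyz
    have : ∀ a, ∃ k : ℤ, y a = z a + k := by
      intro a
      have : ((y a - z a : ℝ) : UnitAddCircle) = 0 := by
        rw [AddCircle.coe_sub, sub_eq_zero]
        exact congrFun hyz a
      obtain ⟨k, hk⟩ := (AddCircle.coe_eq_zero_iff (p := (1 : ℝ))).1 this
      exact ⟨k, by simp at hk; linarith⟩
    choose k hk using this
    rw [← h2 Finset.univ k z]
    congr 1
    rw [Finset.univ_sum_single]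
    exact funext hk
  choose sec hsec using proj_surjective n
  have h4 : (fun x => F (sec x)) ∘ proj n = F := funext fun y => h3 _ _ (hsec _)
  exact ⟨⟨fun x => F (sec x), by
    change ContDiff ℝ (⊤ : ℕ∞) ((fun x => F (sec x)) ∘ proj n)
    rw [h4]
    exact hF⟩, h4⟩

theorem clm_eq_of_single {L M : (Fin (2 * n) → ℝ) →L[ℝ] ℝ}
    (h : ∀ a, L (Pi.single a 1) = M (Pi.single a 1)) : L = M := by
  refine ContinuousLinearMap.coe_injective (LinearMap.pi_ext' fun a => ?_)
  ext
  simpa using h a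

/-- A closed 1-form on the torus is the sum of an exact one and a constant one. -/
theorem exists_pd_add_const_of_closed {α : Fin (2 * n) → Fn n}
    (h : ∀ a b, pd a (α b) = pd b (α a)) :
    ∃ (f : Fn n) (c : Fin (2 * n) → ℝ), ∀ a, α a = pd a f + algebraMap ℝ (Fn n) (c a) := by
  -- The form pulled back to `ℝ^{2n}`, where the Poincaré lemma gives a primitive `F`.
  set w : (Fin (2 * n) → ℝ) → (Fin (2 * n) → ℝ) →L[ℝ] ℝ := fun y =>
    ∑ a, lift (α a) y • ContinuousLinearMap.proj a with hw
  have hwc : ContDiff ℝ (⊤ : ℕ∞) w :=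
    ContDiff.sum fun a _ => (lift_contDiff (α a)).smul contDiff_const
  have hw1 : ∀ y a, w y (Pi.single a 1) = lift (α a) y := by
    intro y a
    simp [hw, Pi.single_apply]
  have hwd : Differentiable ℝ w := hwc.differentiable (by simp)
  have hw2 : ∀ y a b, fderiv ℝ w y (Pi.single a 1) (Pi.single b 1) = lift (pd a (α b)) y := by
    intro y a b
    rw [lift_pd, show lift (α b) = fun y => w y (Pi.single b 1) from
      funext fun y => (hw1 y b).symm, fderiv_clm_apply (hwd y) (differentiableAt_const _)]
    simp
  have hsymm : ∀ y u v, fderiv ℝ w y u v = fderiv ℝ w y v u := by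
    intro y
    have : fderiv ℝ w y = (fderiv ℝ w y).flip :=  by
      refine ContinuousLinearMap.coe_injective (LinearMap.pi_ext' fun a => ?_)
      ext1
      refine clm_eq_of_single fun b => ?_
      simpa [hw2] using congrFun (congrArg lift (h a b)) y
    intro u v
    exact congrArg (fun L => L u v) this
  obtain ⟨F, hF⟩ := convex_univ.exists_forall_hasFDerivAt_of_fderiv_symmetric isOpen_univ
    hwd.differentiableOn fun y _ => hsymm y
  replace hF : ∀ y, HasFDerivAt F (w y) y := fun y => hF y (Set.mem_univ y)
  have hFc : ContDiff ℝ (⊤ : ℕ∞) F := by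
    rw [contDiff_infty_iff_fderiv]
    refine ⟨fun y => (hF y).differentiableAt, ?_⟩
    rwa [show fderiv ℝ F = w from funext fun y => (hF y).fderiv]
  have hwper : ∀ y b, w (y + Pi.single b 1) = w y := by
    intro y b
    refine clm_eq_of_single fun a => ?_
    rw [hw1, hw1, lift, Function.comp_apply, Function.comp_apply, proj_add,
      show proj n (Pi.single b 1) = 0 from ?_, add_zero]
    funext i
    by_cases hi : i = b
    · subst hi
      simp [proj]
    · simp [proj, hi]
  -- The increments of `F` along the lattice are constants, the periods of the form; subtracting the
  -- linear function with the same periods makes `F` descend to the torus.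
  have hconst : ∀ b, ∃ c, ∀ y, F (y + Pi.single b 1) - F y = c := by
    intro b
    refine ⟨F (0 + Pi.single b 1) - F 0, fun y => ?_⟩
    have hd : ∀ y, HasFDerivAt (fun y => F (y + Pi.single b 1) - F y)
        (0 : (Fin (2 * n) → ℝ) →L[ℝ] ℝ) y := by
      intro y
      have := ((hasFDerivAt_comp_add_right (Pi.single b 1)).2 (hF (y + Pi.single b 1))).sub (hF y)
      rwa [hwper, sub_self] at this
    exact is_const_of_fderiv_eq_zero (fun y => (hd y).differentiableAt)
      (fun y => (hd y).fderiv) y 0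
  choose c hc using hconst
  set p : Fin (2 * n) → (Fin (2 * n) → ℝ) →L[ℝ] ℝ := fun a => ContinuousLinearMap.proj a with hp
  have hG : ∀ y, HasFDerivAt (fun y => F y - ∑ a, c a * y a) (w y - ∑ a, c a • p a) y := by
    intro y
    exact (hF y).sub (HasFDerivAt.fun_sum fun a _ => ((p a).hasFDerivAt (x := y)).const_mul (c a))
  obtain ⟨f, hf⟩ := exists_lift_eq (n := n) (F := fun y => F y - ∑ a, c a * y a)
    (hFc.sub (ContDiff.sum fun a _ => contDiff_const.mul (p a).contDiff)) (by
      intro y b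
      have : ∑ a, c a * (y + Pi.single b 1 : Fin (2 * n) → ℝ) a = ∑ a, c a * y a + c b := by
        simp [mul_add, Finset.sum_add_distrib, Pi.single_apply]
      rw [this, ← hc b y]
      ring)
  refine ⟨f, c, fun a => lift_injective (funext fun y => ?_)⟩
  rw [lift_add, Pi.add_apply, lift_pd, hf, (hG y).fderiv, lift_algebraMap]
  simp [hw1, hp, Pi.single_apply]

end Calculus

/-! ### Symplectic linear algebra: traces of tensors of Ricci shape -/

namespace InvariantSymplecticForm

variable {n : ℕ} (ω : InvariantSymplecticForm n)

theorem mat_mul_inv (a c : Fin (2 * n)) :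
    ∑ b, ω.mat a b * ω.mat⁻¹ b c = if a = c then 1 else 0 := by
  rw [← Matrix.mul_apply, Matrix.mul_nonsing_inv _ ω.nondegenerate, Matrix.one_apply]

theorem inv_mul_mat (a c : Fin (2 * n)) :
    ∑ b, ω.mat⁻¹ a b * ω.mat b c = if a = c then 1 else 0 := by
  rw [← Matrix.mul_apply, Matrix.nonsing_inv_mul _ ω.nondegenerate, Matrix.one_apply]

theorem transpose_mat : ω.mat.transpose = -ω.mat := by
  ext a b
  simpa using ω.skew b a

theorem inv_skew (a b : Fin (2 * n)) : ω.mat⁻¹ a b = -ω.mat⁻¹ b a := by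
  have h : (-ω.mat)⁻¹ = -ω.mat⁻¹ := by
    refine Matrix.inv_eq_left_inv ?_
    rw [neg_mul_neg, Matrix.nonsing_inv_mul _ ω.nondegenerate]
  rw [← transpose_mat, ← Matrix.transpose_nonsing_inv] at h
  simpa using congrFun (congrFun h b) a

variable {S : Type*} [AddCommGroup S] [Module ℝ S]

/-- The contraction of a bilinear form with the inverse of `ω`. -/
def contract (T : Fin (2 * n) → Fin (2 * n) → S) : S := ∑ a, ∑ b, ω.mat⁻¹ b a • T a b

theorem contract_zero : ω.contract (fun _ _ => (0 : S)) = 0 := by simp [contract]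

theorem contract_add (T U : Fin (2 * n) → Fin (2 * n) → S) :
    ω.contract (fun a b => T a b + U a b) = ω.contract T + ω.contract U := by
  simp [contract, smul_add, Finset.sum_add_distrib]

theorem contract_sub (T U : Fin (2 * n) → Fin (2 * n) → S) :
    ω.contract (fun a b => T a b - U a b) = ω.contract T - ω.contract U := by
  simp [contract, smul_sub, Finset.sum_sub_distrib]

theorem contract_smul (r : ℝ) (T : Fin (2 * n) → Fin (2 * n) → S) :
    ω.contract (fun a b => r • T a b) = r • ω.contract T := by
  simp [contract, Finset.smul_sum, smul_comm r]

theorem contract_sum {ι : Type*} (t : Finset ι) (T : ι → Fin (2 * n) → Fin (2 * n) → S) :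
    ω.contract (fun a b => ∑ i ∈ t, T i a b) = ∑ i ∈ t, ω.contract (T i) := by
  simp_rw [contract, Finset.smul_sum]
  exact (Finset.sum_congr rfl fun a _ => Finset.sum_comm).trans Finset.sum_comm

theorem contract_form (X : S) : ω.contract (fun a b => ω.mat a b • X) = (2 * n : ℝ) • X := by
  have h : ∀ a, ∑ b, ω.mat⁻¹ b a • ω.mat a b • X = X := by
    intro a
    simp_rw [smul_smul, ← Finset.sum_smul, mul_comm (ω.mat⁻¹ _ a), mat_mul_inv]
    simp
  simp [contract, h, ← Nat.cast_smul_eq_nsmul ℝ]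

theorem contract_form_left (c : Fin (2 * n)) (F : Fin (2 * n) → S) :
    ω.contract (fun a b => ω.mat a c • F b) = F c := by
  rw [contract, Finset.sum_comm]
  simp_rw [smul_smul, ← Finset.sum_smul, inv_mul_mat]
  simp

theorem contract_form_right (c : Fin (2 * n)) (F : Fin (2 * n) → S) :
    ω.contract (fun a b => ω.mat b c • F a) = -F c := by
  have h : ∀ a, ∑ b, ω.mat⁻¹ b a • ω.mat b c • F a = if a = c then -F a else 0 := by
    intro a
    simp_rw [smul_smul, ← Finset.sum_smul, ω.inv_skew _ a, neg_mul, Finset.sum_neg_distrib,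
      inv_mul_mat]
    split_ifs <;> simp
  simp [contract, h]

/-- The shape of a curvature tensor of Ricci type, built from a bilinear form `s`. -/
def ricciForm (s : Fin (2 * n) → Fin (2 * n) → S) (a b c d : Fin (2 * n)) : S :=
  (2 : ℝ) • ω.mat a b • s c d + ω.mat a c • s b d + ω.mat a d • s b c
    - ω.mat b c • s a d - ω.mat b d • s a c

/-- This trace recovers `s` from the curvature. The term in `s b c` drops out, a symmetric form
having no trace against the skew inverse of `ω`. -/
theorem contract_ricciForm (s : Fin (2 * n) → Fin (2 * n) → S) (hs : ∀ a b, s a b = s b a)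
    (a d : Fin (2 * n)) :
    ω.contract (fun b c => ω.ricciForm s a b c d) = -((2 * n + 2 : ℝ) • s a d) := by
  have h0 : ω.contract s = 0 := by
    have : ω.contract s = -ω.contract s := by
      conv_lhs => rw [contract, Finset.sum_comm]
      simp_rw [contract, ← Finset.sum_neg_distrib, ← neg_smul, ← inv_skew]
      simp_rw [hs]
    have h2 : (2 : ℝ) • ω.contract s = 0 := by linear_combination (norm := module) this
    exact (smul_eq_zero.1 h2).resolve_left two_ne_zero
  have h : (fun b c => ω.ricciForm s a b c d) = fun b c =>
      (-2 : ℝ) • ω.mat b a • s c d - ω.mat c a • s b d + ω.mat a d • s b c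
        - ω.mat b c • s a d - ω.mat b d • s a c := by
    funext b c
    rw [ricciForm, ω.skew b a, ω.skew c a]
    module
  rw [h]
  simp only [contract_add, contract_sub, contract_form, contract_form_left, contract_form_right,
    contract_smul, h0]
  module

/-- A trilinear form, symmetric in the last two arguments, whose associated curvature derivative
satisfies the second Bianchi identity is determined by a linear form. -/
theorem exists_eq_of_bianchi (hn : 2 ≤ n) (s : Fin (2 * n) → Fin (2 * n) → Fin (2 * n) → S)
    (hs : ∀ e c d, s e c d = s e d c)
    (H : ∀ e a b c d, ω.ricciForm (s e) a b c d + ω.ricciForm (s a) b e c d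
      + ω.ricciForm (s b) e a c d = 0) :
    ∃ u : Fin (2 * n) → S, ∀ e c d, s e c d = ω.mat e c • u d + ω.mat e d • u c := by
  set v : Fin (2 * n) → S := fun d => ω.contract (fun a b => s a b d) with hv
  set v' : Fin (2 * n) → S := fun d => ω.contract (fun a b => s b a d) with hv'
  have hvv : ∀ d, v' d = -v d := by
    intro d
    rw [hv, hv']
    simp only [contract]
    rw [Finset.sum_comm]
    simp_rw [← Finset.sum_neg_distrib, ← neg_smul, ← inv_skew]
  -- The trace of the Bianchi identity over `a` and `b`.
  have key : ∀ e c d, (2 * n : ℝ) • s e c d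
      = s c e d + s d e c + ω.mat e c • v d + ω.mat e d • v c := by
    intro e c d
    have h1 : ω.contract (fun a b => ω.ricciForm (s e) a b c d + ω.ricciForm (s a) b e c d
        + ω.ricciForm (s b) e a c d) = 0 := by simp only [H, contract_zero]
    have h2 : (fun a b => ω.ricciForm (s e) a b c d + ω.ricciForm (s a) b e c d
        + ω.ricciForm (s b) e a c d) = fun a b =>
        ((2 : ℝ) • ω.mat a b • s e c d + ω.mat a c • s e b d + ω.mat a d • s e b c
          - ω.mat b c • s e a d - ω.mat b d • s e a c)
        + ((2 : ℝ) • ω.mat b e • s a c d + ω.mat b c • s a e d + ω.mat b d • s a e c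
          - ω.mat e c • s a b d - ω.mat e d • s a b c)
        + ((-2 : ℝ) • ω.mat a e • s b c d + ω.mat e c • s b a d + ω.mat e d • s b a c
          - ω.mat a c • s b e d - ω.mat a d • s b e c) := by
      funext a b
      simp only [ricciForm]
      rw [ω.skew e a]
      module
    rw [h2] at h1
    simp only [contract_add, contract_sub, contract_form, contract_form_left,
      contract_form_right, contract_smul] at h1
    change (2 : ℝ) • (2 * n : ℝ) • s e c d + s e c d + s e d c - -s e c d - -s e d c
      + ((2 : ℝ) • (-s e c d) + -s c e d + -s d e c - ω.mat e c • v d - ω.mat e d • v c)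
      + ((-2 : ℝ) • s e c d + ω.mat e c • v' d + ω.mat e d • v' c - s c e d - s d e c) = 0 at h1
    rw [hs e d c, hvv, hvv] at h1
    linear_combination (norm := module) (1 / 2 : ℝ) • h1
  -- Summing `key` cyclically, the `ω` terms cancel by skewness and the factor `2n - 2` remains,
  -- which is nonzero only because `n ≥ 2`.
  have hsum : ∀ e c d, s e c d + s c e d + s d e c = 0 := by
    intro e c d
    have h1 := key e c d
    have h2 := key c e d
    have h3 := key d e c
    rw [hs d c e] at h2
    rw [hs c d e] at h3
    rw [hs e d c] at h3
    rw [ω.skew c e] at h2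
    rw [ω.skew d e, ω.skew d c] at h3
    have h4 : (2 * n - 2 : ℝ) • (s e c d + s c e d + s d e c) = 0 := by
      linear_combination (norm := module) h1 + h2 + h3
    have h5 : (2 * n - 2 : ℝ) ≠ 0 := by
      have : (2 : ℝ) ≤ n := by exact_mod_cast hn
      linarith
    exact (smul_eq_zero.1 h4).resolve_left h5
  refine ⟨fun d => (1 / (2 * n + 1) : ℝ) • v d, fun e c d => ?_⟩
  have hN : (2 * n + 1 : ℝ) ≠ 0 := by positivity
  have h4 : (2 * n + 1 : ℝ) • s e c d = ω.mat e c • v d + ω.mat e d • v c := by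
    linear_combination (norm := module) key e c d + hsum e c d
  have h5 := congrArg (fun x => (1 / (2 * n + 1) : ℝ) • x) h4
  simp only [smul_smul, one_div, inv_mul_cancel₀ hN, one_smul] at h5
  rw [h5, one_div]
  module

/-- The hypothesis is what commuting second derivatives yield once first derivatives have the form
of `exists_eq_of_bianchi`. On tracing over `f` and `c` the second and third terms cancel, leaving
`2n • P` against the trace of `P`. -/
theorem exists_eq_smul_form (hn : 1 ≤ n) (P : Fin (2 * n) → Fin (2 * n) → S)
    (H : ∀ f e c d, ω.mat f c • P e d + ω.mat f d • P e c - ω.mat e c • P f d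
      - ω.mat e d • P f c = 0) :
    ∃ τ : S, ∀ e d, P e d = ω.mat e d • τ := by
  refine ⟨(1 / (2 * n) : ℝ) • ω.contract P, fun e d => ?_⟩
  have h1 : ω.contract (fun f c => ω.mat f c • P e d + ω.mat f d • P e c - ω.mat e c • P f d
      - ω.mat e d • P f c) = 0 := by simp only [H, contract_zero]
  have h2 : (fun f c => ω.mat f c • P e d + ω.mat f d • P e c - ω.mat e c • P f d
      - ω.mat e d • P f c) = fun f c => ω.mat f c • P e d + ω.mat f d • P e c
      + ω.mat c e • P f d - ω.mat e d • P f c := by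
    funext f c
    rw [ω.skew e c]
    module
  rw [h2] at h1
  simp only [contract_add, contract_sub, contract_form, contract_form_left,
      contract_form_right, contract_smul] at h1
  have hN : (2 * n : ℝ) ≠ 0 := by
    have : (1 : ℝ) ≤ n := by exact_mod_cast hn
    positivity
  have h4 : (2 * n : ℝ) • P e d = ω.mat e d • ω.contract P := by
    linear_combination (norm := module) h1
  have h5 := congrArg (fun x => (1 / (2 * n) : ℝ) • x) h4
  simp only [smul_smul, one_div, inv_mul_cancel₀ hN, one_smul] at h5
  rw [h5, smul_smul, one_div, mul_comm]

theorem sum_inv_smul_sum_form (w : Fin (2 * n) → S) (c : Fin (2 * n)) :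
    ∑ b, ω.mat⁻¹ b c • ∑ a, ω.mat a b • w a = w c := by
  simp_rw [Finset.smul_sum]
  rw [Finset.sum_comm]
  simp_rw [smul_smul, ← Finset.sum_smul, mul_comm (ω.mat⁻¹ _ _), mat_mul_inv]
  simp

theorem eq_zero_of_sum_form_eq_zero {w : Fin (2 * n) → S}
    (h : ∀ b, ∑ a, ω.mat a b • w a = 0) : w = 0 := by
  funext c
  rw [← ω.sum_inv_smul_sum_form w c]
  simp [h]

variable {K : Type*} [CommRing K] [IsDomain K] [Algebra ℝ K]

theorem contract_mul {K : Type*} [CommRing K] [Algebra ℝ K] (w : K)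
    (T : Fin (2 * n) → Fin (2 * n) → K) :
    ω.contract (fun a b => w * T a b) = w * ω.contract T := by
  simp_rw [contract, Finset.mul_sum, mul_smul_comm]

/-- The Ricci trace shows that `w` lies in the kernel of `s`. What remains of the hypothesis is a
relation between `s` and the covector `θ` dual to `w` that forces all products `θ b * s c d` to
vanish; a domain then decides. -/
theorem eq_zero_or_of_ricciForm_eq_zero {s : Fin (2 * n) → Fin (2 * n) → K}
    (hs : ∀ a b, s a b = s b a) {w : Fin (2 * n) → K}
    (H : ∀ b c d, ∑ a, w a * ω.ricciForm s a b c d = 0) : w = 0 ∨ s = 0 := by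
  have h1 : ∀ d, ∑ a, w a * s a d = 0 := by
    intro d
    have h2 : ω.contract (fun b c => ∑ a, w a * ω.ricciForm s a b c d)
        = ∑ a, w a * ω.contract (fun b c => ω.ricciForm s a b c d) := by
      simp_rw [contract_sum, contract_mul]
    simp_rw [H, contract_ricciForm ω s hs, contract_zero] at h2
    have h3 : (2 * n + 2 : ℝ) • ∑ a, w a * s a d = 0 := by
      simp_rw [mul_neg, Finset.sum_neg_distrib, mul_smul_comm, ← Finset.smul_sum] at h2
      exact (neg_eq_zero.1 h2.symm)
    exact (smul_eq_zero.1 h3).resolve_left (by positivity)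
  set θ : Fin (2 * n) → K := fun b => ∑ a, ω.mat a b • w a with hθ
  have h4 : ∀ b c d, 2 * θ b * s c d + θ c * s b d + θ d * s b c = 0 := by
    intro b c d
    have := H b c d
    simp only [ricciForm, mul_add, mul_sub, Finset.sum_add_distrib, Finset.sum_sub_distrib,
      mul_smul_comm, ← Finset.smul_sum, h1, smul_zero, sub_zero] at this
    simp only [Finset.smul_sum] at this
    simp only [hθ, Finset.mul_sum, Finset.sum_mul]
    rw [← this]
    congr 1
    · congr 1
      · exact Finset.sum_congr rfl fun a _ => by simp only [Algebra.smul_def, map_ofNat]; ring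
      · exact Finset.sum_congr rfl fun a _ => by simp only [Algebra.smul_def]; ring
    · exact Finset.sum_congr rfl fun a _ => by simp only [Algebra.smul_def]; ring
  have h5 : ∀ b c d, θ b * s c d = 0 := by
    intro b c d
    -- The three permutations of `h4` form a linear system with `2` on the diagonal and `1`
    -- elsewhere, which is invertible.
    have h6 : (4 : ℝ) • (θ b * s c d) = 0 := by
      have e1 := h4 b c d
      have e2 := h4 c b d
      have e3 := h4 d b c
      rw [hs c b] at e2
      rw [hs d c, hs d b] at e3
      rw [Algebra.smul_def, map_ofNat]
      linear_combination 3 * e1 - e2 - e3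
    exact (smul_eq_zero.1 h6).resolve_left (by norm_num)
  by_cases hw : w = 0
  · exact Or.inl hw
  · right
    have : ∃ b, θ b ≠ 0 := by
      by_contra! hcon
      exact hw (ω.eq_zero_of_sum_form_eq_zero hcon)
    obtain ⟨b, hb⟩ := this
    funext c d
    exact (mul_eq_zero.1 (h5 b c d)).resolve_left hb

end InvariantSymplecticForm

/-! ### Constant connections of Ricci type -/

namespace InvariantSymplecticForm

variable {n : ℕ} (ω : InvariantSymplecticForm n) {K : Type*} [CommRing K] [Algebra ℝ K]

/-- The matrix of `ω` with entries in an `ℝ`-algebra. -/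
def matMap (K : Type*) [CommRing K] [Algebra ℝ K] : Matrix (Fin (2 * n)) (Fin (2 * n)) K :=
  ω.mat.map (algebraMap ℝ K)

theorem matMap_apply (a b : Fin (2 * n)) : ω.matMap K a b = algebraMap ℝ K (ω.mat a b) := rfl

theorem matMap_skew (a b : Fin (2 * n)) : ω.matMap K a b = -ω.matMap K b a := by
  rw [matMap_apply, matMap_apply, ω.skew a b, map_neg]

theorem ricciForm_eq (s : Fin (2 * n) → Fin (2 * n) → K) (a b c d : Fin (2 * n)) :
    ω.ricciForm s a b c d = 2 * ω.matMap K a b * s c d + ω.matMap K a c * s b d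
      + ω.matMap K a d * s b c - ω.matMap K b c * s a d - ω.matMap K b d * s a c := by
  simp only [ricciForm, Algebra.smul_def, matMap_apply, map_ofNat]
  ring

/-- The tensor `ricciForm` as a family of matrices, for a matrix `s`. -/
def ricciMat (s : Matrix (Fin (2 * n)) (Fin (2 * n)) K) (a b : Fin (2 * n)) :
    Matrix (Fin (2 * n)) (Fin (2 * n)) K :=
  Matrix.of fun c d => ω.ricciForm (fun c d => s c d) a b c d

theorem ricciMat_apply (s : Matrix (Fin (2 * n)) (Fin (2 * n)) K) (a b c d : Fin (2 * n)) :
    ω.ricciMat s a b c d = 2 * ω.matMap K a b * s c d + ω.matMap K a c * s b d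
      + ω.matMap K a d * s b c - ω.matMap K b c * s a d - ω.matMap K b d * s a c :=
  ω.ricciForm_eq _ a b c d

/-- The derivative of a tensor of Ricci type along a connection with constant coefficients
preserving `ω`. -/
theorem ricciMat_derivative {G : Matrix (Fin (2 * n)) (Fin (2 * n)) K}
    (hG : ∀ x y, ∑ f, (G x f * ω.matMap K f y + G y f * ω.matMap K x f) = 0)
    (s : Matrix (Fin (2 * n)) (Fin (2 * n)) K) (a b c d : Fin (2 * n)) :
    ω.ricciMat (G * s + s * G.transpose) a b c d
      = ∑ f, (G c f * ω.ricciMat s a b f d + ω.ricciMat s a b c f * G d f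
        + G a f * ω.ricciMat s f b c d + G b f * ω.ricciMat s a f c d) := by
  have h : ∑ f, (G c f * ω.ricciMat s a b f d + ω.ricciMat s a b c f * G d f
        + G a f * ω.ricciMat s f b c d + G b f * ω.ricciMat s a f c d)
      = ω.ricciMat (G * s + s * G.transpose) a b c d
      + 2 * (∑ f, (G a f * ω.matMap K f b + G b f * ω.matMap K a f)) * s c d
      + (∑ f, (G a f * ω.matMap K f c + G c f * ω.matMap K a f)) * s b d
      + (∑ f, (G a f * ω.matMap K f d + G d f * ω.matMap K a f)) * s b c
      - (∑ f, (G b f * ω.matMap K f c + G c f * ω.matMap K b f)) * s a d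
      - (∑ f, (G b f * ω.matMap K f d + G d f * ω.matMap K b f)) * s a c := by
    simp only [ricciMat_apply, Matrix.add_apply, Matrix.mul_apply, Matrix.transpose_apply,
      ← Finset.sum_add_distrib, Finset.mul_sum, Finset.sum_mul, ← Finset.sum_sub_distrib]
    exact Finset.sum_congr rfl fun f _ => by ring
  rw [h]
  simp only [hG]
  ring

variable [IsDomain K]

/-- An invariant symplectic connection of Ricci type has vanishing Ricci tensor. Here `Γ a` is the
matrix of `∇_{∂_a}` in the frame `∂_b`, whose rows are indexed by the argument. -/
theorem ricci_eq_zero_of_const (hn : 2 ≤ n) (Γ : Fin (2 * n) → Matrix (Fin (2 * n)) (Fin (2 * n)) K)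
    (s : Matrix (Fin (2 * n)) (Fin (2 * n)) K) (hs : s.transpose = s)
    (htor : ∀ a b c, Γ a b c = Γ b a c)
    (hα : ∀ a, (Γ a * ω.matMap K).transpose = Γ a * ω.matMap K)
    (H : ∀ a b, (Γ b * Γ a - Γ a * Γ b) * ω.matMap K = ω.ricciMat s a b) :
    s = 0 := by
  set W := ω.matMap K with hW
  have hs' : ∀ a b, s a b = s b a := fun a b => congrFun (congrFun hs b) a
  have hWt : W.transpose = -W := by ext a b; exact ω.matMap_skew b a
  obtain ⟨Wi, hWWi, hWiW⟩ : ∃ Wi, W * Wi = 1 ∧ Wi * W = 1 := by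
    refine ⟨ω.mat⁻¹.map (algebraMap ℝ K), ?_, ?_⟩
    · rw [hW, matMap, ← Matrix.map_mul, Matrix.mul_nonsing_inv _ ω.nondegenerate]
      simp
    · rw [hW, matMap, ← Matrix.map_mul, Matrix.nonsing_inv_mul _ ω.nondegenerate]
      simp
  have hWit : Wi.transpose = -Wi := by
    have h1 : Wi.transpose * W = -1 := by
      rw [← neg_neg W, ← hWt, mul_neg, ← Matrix.transpose_mul, hWWi, Matrix.transpose_one]
    calc Wi.transpose = Wi.transpose * (W * Wi) := by rw [hWWi, mul_one]
      _ = -Wi := by rw [← mul_assoc, h1, neg_one_mul]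
  have hΓ : ∀ e, W * (Γ e).transpose = -(Γ e * W) := by
    intro e
    have := hα e
    rw [Matrix.transpose_mul, hWt, neg_mul] at this
    rw [← this, neg_neg]
  have hΓ0 : ∀ e x y, ∑ f, (Γ e x f * W f y + Γ e y f * W x f) = 0 := by
    intro e x y
    have := congrFun (congrFun (hΓ e) x) y
    simp only [Matrix.mul_apply, Matrix.neg_apply, Matrix.transpose_apply] at this
    rw [Finset.sum_add_distrib, ← neg_eq_iff_add_eq_zero, ← this]
    exact Finset.sum_congr rfl fun f _ => mul_comm _ _
  have hEsymm : ∀ a b c d, ω.ricciMat s a b c d = -ω.ricciMat s b a c d := by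
    intro a b c d
    rw [ricciMat_apply, ricciMat_apply, ω.matMap_skew a b]
    ring
  -- Up to sign, the covariant derivative of `s` along `∂_e`.
  set S : Fin (2 * n) → Matrix (Fin (2 * n)) (Fin (2 * n)) K := fun e =>
    Γ e * s + s * (Γ e).transpose with hS
  have hSsymm : ∀ e c d, S e c d = S e d c := by
    intro e c d
    have : (S e).transpose = S e := by
      simp only [hS, Matrix.transpose_add, Matrix.transpose_mul, hs, Matrix.transpose_transpose]
      exact add_comm _ _
    exact congrFun (congrFun this d) c
  -- The Jacobi identity for the matrices `Γ`, which preserve `ω`. It is the second Bianchi identity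
  -- without the terms differentiating the first two slots; those cancel in the cyclic sum because
  -- the torsion vanishes.
  have hjac : ∀ e a b, Γ e * ω.ricciMat s a b + ω.ricciMat s a b * (Γ e).transpose + (Γ a * ω.ricciMat s b e + ω.ricciMat s b e * (Γ a).transpose)
      + (Γ b * ω.ricciMat s e a + ω.ricciMat s e a * (Γ b).transpose) = 0 := by
    intro e a b
    rw [← H, ← H, ← H]
    simp only [mul_assoc, hΓ]
    noncomm_ring
  obtain ⟨u, hu⟩ := ω.exists_eq_of_bianchi hn (fun e c d => S e c d) hSsymm (by
    intro e a b c d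
    have h1 := congrFun (congrFun (hjac e a b) c) d
    simp only [Matrix.add_apply, Matrix.mul_apply, Matrix.transpose_apply, Matrix.zero_apply,
      ← Finset.sum_add_distrib] at h1
    change ω.ricciMat (S e) a b c d + ω.ricciMat (S a) b e c d + ω.ricciMat (S b) e a c d = 0
    rw [ω.ricciMat_derivative (hΓ0 e), ω.ricciMat_derivative (hΓ0 a),
      ω.ricciMat_derivative (hΓ0 b), ← Finset.sum_add_distrib, ← Finset.sum_add_distrib, ← h1]
    refine Finset.sum_congr rfl fun f _ => ?_
    rw [htor a e, htor b e, htor b a, hEsymm f b, hEsymm f e, hEsymm f a]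
    ring)
  simp only [Algebra.smul_def, ← matMap_apply, ← hW] at hu
  -- Up to sign, the covariant derivative of the covector `u`; it is symmetric because the torsion
  -- vanishes.
  set M : Fin (2 * n) → Fin (2 * n) → K := fun f c => ∑ g, Γ f c g * u g with hM
  have hMsymm : ∀ f c, M f c = M c f := fun f c => by simp only [hM, htor f c]
  set T := Wi * s with hT
  set q := s * T with hq
  have hqt : q.transpose = -q := by
    rw [hq, hT, Matrix.transpose_mul, Matrix.transpose_mul, hs, hWit]
    noncomm_ring
  have hqskew : ∀ c d, q d c = -q c d := fun c d => congrFun (congrFun hqt c) d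
  have hWT : W * T = s := by rw [hT, ← mul_assoc, hWWi, one_mul]
  have hαsymm : ∀ f e c, (Γ f * W) c e = (Γ e * W) c f := by
    have h1 : ∀ f e c, (Γ f * W) c e = (Γ f * W) e c := fun f e c =>
      congrFun (congrFun (hα f) e) c
    have h2 : ∀ f e c, (Γ f * W) c e = (Γ c * W) f e := fun f e c => by
      simp only [Matrix.mul_apply, htor f c]
    intro f e c
    rw [h2, h1, h2, h1, h2]
  -- The Ricci identity: the commutator of two covariant derivatives of `s` is the action of the
  -- curvature on `s`.
  have hcurv : ∀ f e, (Γ f * S e + S e * (Γ f).transpose) - (Γ e * S f + S f * (Γ e).transpose)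
      = ω.ricciMat s e f * T + (ω.ricciMat s e f * T).transpose := by
    intro f e
    have h1 : ω.ricciMat s e f * T = (Γ f * Γ e - Γ e * Γ f) * s := by
      rw [← H e f, mul_assoc, hWT]
    rw [h1, Matrix.transpose_mul, hs, Matrix.transpose_sub, Matrix.transpose_mul,
      Matrix.transpose_mul]
    simp only [hS]
    noncomm_ring
  -- Both sides of `hcurv` are expanded, one by `hu` and the other by the Ricci shape; the terms
  -- pairing `u` with `Γ * W` cancel by the total symmetry of the latter.
  have hP : ∀ f e c d, W f c * (q e d - M e d) + W f d * (q e c - M e c)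
      - W e c * (q f d - M f d) - W e d * (q f c - M f c) = 0 := by
    intro f e c d
    have h1 : ∀ f e c d, (Γ f * S e + S e * (Γ f).transpose) c d
        = -(Γ f * W) c e * u d - (Γ f * W) d e * u c + W e d * M f c + W e c * M f d := by
      intro f e c d
      have h2 : ∀ g, W e g = -W g e := fun g => ω.matMap_skew e g
      simp only [Matrix.add_apply, Matrix.mul_apply, Matrix.transpose_apply, hu, hM, h2,
        ← Finset.sum_add_distrib, Finset.mul_sum, ← Finset.sum_sub_distrib, Finset.sum_mul,
        ← Finset.sum_neg_distrib]
      refine Finset.sum_congr rfl fun g _ => ?_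
      ring
    have h3 : ∀ c d, (ω.ricciMat s e f * T) c d = 2 * W e f * q c d + W e c * q f d - W f c * q e d
        + s f c * (W * T) e d - s e c * (W * T) f d := by
      intro c d
      simp only [hq, Matrix.mul_apply, ricciMat_apply,
        ← Finset.sum_add_distrib, Finset.mul_sum, ← Finset.sum_sub_distrib]
      refine Finset.sum_congr rfl fun g _ => ?_
      ring
    have h4 := congrFun (congrFun (hcurv f e) c) d
    rw [Matrix.sub_apply, h1, h1, Matrix.add_apply, Matrix.transpose_apply, h3, h3, hWT,
      hqskew c d, hαsymm f e c, hαsymm f e d] at h4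
    linear_combination h4
  obtain ⟨τ, hτ⟩ := ω.exists_eq_smul_form (by omega) (fun e d => q e d - M e d) (by
    intro f e c d
    simp only [Algebra.smul_def, ← matMap_apply]
    exact hP f e c d)
  -- `q - M` is a multiple of `W`; since `q` and `W` are skew, the symmetric part `M` is zero.
  have hM0 : ∀ e d, M e d = 0 := by
    intro e d
    have h1 := hτ e d
    have h2 := hτ d e
    simp only [Algebra.smul_def, ← matMap_apply] at h1 h2
    rw [hqskew e d, hMsymm d e, ω.matMap_skew d e] at h2
    have h3 : (2 : ℝ) • M e d = 0 := by
      rw [Algebra.smul_def, map_ofNat]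
      linear_combination -h1 - h2
    exact (smul_eq_zero.1 h3).resolve_left two_ne_zero
  -- If `w` contracts `Γ` to zero, it contracts every commutator, hence the curvature, to zero in
  -- the first slot.
  have hvanish : ∀ w : Fin (2 * n) → K, (∀ c d, ∑ a, w a * (Γ a * W) c d = 0) → w = 0 ∨ s = 0 := by
    intro w hw
    refine ω.eq_zero_or_of_ricciForm_eq_zero hs' fun b c d => ?_
    have h1 : ∑ a, w a • (Γ a * W) = 0 := by
      ext c d
      rw [Matrix.sum_apply]
      simpa using hw c d
    have h2 : ∑ a, w a • Γ a = 0 := by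
      have := congrArg (· * Wi) h1
      simpa [Finset.sum_mul, mul_assoc, hWWi] using this
    have h3 : ∑ a, w a • ω.ricciMat s a b = 0 := by
      have : ∑ a, w a • ω.ricciMat s a b = (Γ b * (∑ a, w a • Γ a) - (∑ a, w a • Γ a) * Γ b) * W := by
        simp only [← H, Finset.mul_sum, Finset.sum_mul, ← Finset.sum_sub_distrib, sub_mul, smul_sub,
          mul_smul_comm, smul_mul_assoc]
      rw [this, h2]
      simp
    have h4 := congrFun (congrFun h3 c) d
    rw [Matrix.sum_apply] at h4
    have h5 : ∑ a, w a * ω.ricciMat s a b c d = 0 := by simpa using h4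
    exact h5
  have hαtot : ∀ a c d, (Γ a * W) c d = (Γ c * W) d a := by
    intro a c d
    rw [hαsymm c a d]
    exact congrFun (congrFun (hα a) d) c
  -- The vector dual to `u`: by total symmetry its contraction with `Γ * W` is `M`, which vanishes.
  rcases hvanish (Wi.mulVec u) (by
    intro c d
    have h1 : ((Γ c * W).mulVec (Wi.mulVec u)) d = 0 := by
      rw [Matrix.mulVec_mulVec, mul_assoc, hWWi, mul_one]
      exact hM0 c d
    rw [← h1, Matrix.mulVec, dotProduct]
    exact Finset.sum_congr rfl fun a _ => by rw [hαtot, mul_comm]) with h | h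
  · have hu0 : u = 0 := by
      rw [← Matrix.one_mulVec u, ← hWWi, ← Matrix.mulVec_mulVec, h, Matrix.mulVec_zero]
    have hskew : ∀ e c d, (Γ e * s) c d = -(Γ e * s) d c := by
      intro e c d
      have h1 := hu e c d
      simp only [hu0, Pi.zero_apply, mul_zero, add_zero] at h1
      have h2 : (s * (Γ e).transpose) c d = (Γ e * s) d c := by
        rw [← Matrix.transpose_apply (s * _), Matrix.transpose_mul, hs, Matrix.transpose_transpose]
      rw [← h2]
      exact eq_neg_of_add_eq_zero_left h1
    have hsymm : ∀ e c d, (Γ e * s) c d = (Γ c * s) e d := by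
      intro e c d
      simp only [Matrix.mul_apply, htor e c]
    -- A tensor symmetric in its first two indices and skew in its last two is zero.
    have hzero : ∀ e c d, (Γ e * s) c d = 0 := by
      intro e c d
      have h1 : (2 : ℝ) • (Γ e * s) c d = 0 := by
        rw [Algebra.smul_def, map_ofNat]
        linear_combination hsymm e c d + hskew c e d - hsymm c d e - hskew d c e
          + hsymm d e c + hskew e d c
      exact (smul_eq_zero.1 h1).resolve_left two_ne_zero
    by_contra hs0
    -- Each column of `T` contracts `Γ * W` to an entry of `Γ * s`, already known to vanish.
    have hT0 : T = 0 := by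
      ext a x
      refine congrFun ((hvanish (fun a => T a x) fun c d => ?_).resolve_right hs0) a
      rw [← hzero c d x, ← hWT, ← mul_assoc, Matrix.mul_apply]
      exact Finset.sum_congr rfl fun a _ => by rw [hαtot, mul_comm]
    exact hs0 (by rw [← hWT, hT0, mul_zero])
  · exact h

end InvariantSymplecticForm

/-! ### The linearised equation on the torus -/

section LinearEquation

variable {n : ℕ}

theorem exists_const_add {f : Fn n} (hf : ∃ r : ℝ, f = algebraMap ℝ (Fn n) r) {g : Fn n}
    (hg : ∃ r : ℝ, g = algebraMap ℝ (Fn n) r) : ∃ r : ℝ, f + g = algebraMap ℝ (Fn n) r := by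
  obtain ⟨r, rfl⟩ := hf
  obtain ⟨r', rfl⟩ := hg
  exact ⟨r + r', (map_add _ _ _).symm⟩

theorem exists_const_smul {f : Fn n} (hf : ∃ r : ℝ, f = algebraMap ℝ (Fn n) r) (c : ℝ) :
    ∃ r : ℝ, c • f = algebraMap ℝ (Fn n) r := by
  obtain ⟨r, rfl⟩ := hf
  exact ⟨c * r, by rw [map_mul, Algebra.smul_def]⟩

/-- A symmetric tensor with exact differential is, up to a constant, a third derivative. -/
theorem exists_third_derivative (α : Fin (2 * n) → Fin (2 * n) → Fin (2 * n) → Fn n)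
    (h12 : ∀ a b c, α a b c = α b a c) (h23 : ∀ a b c, α a b c = α a c b)
    (h : ∀ a b c d, pd a (α b c d) = pd b (α a c d)) :
    ∃ (f : Fn n) (r : Fin (2 * n) → Fin (2 * n) → Fin (2 * n) → ℝ),
      ∀ a b c, α a b c = pd a (pd b (pd c f)) + algebraMap ℝ (Fn n) (r a b c) := by
  -- The index symmetries of `α` pass to the potentials only up to constants; a curl equal to a
  -- constant has mean zero, so it vanishes and the next integration is possible.
  choose B r hB using fun c d => exists_pd_add_const_of_closed (α := fun b => α b c d)
    fun a b => h a b c d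
  have hB1 : ∀ d b c, pd b (B c d) = pd c (B b d) := by
    intro d b c
    refine pd_sub_pd_eq_zero (r := r b d c - r c d b) ?_
    have h1 := hB c d b
    rw [h12, hB b d c] at h1
    rw [map_sub]
    linear_combination -h1
  choose C r' hC using fun d => exists_pd_add_const_of_closed (α := fun b => B b d) (hB1 d)
  have hC1 : ∀ c d, pd c (C d) = pd d (C c) := by
    intro c d
    -- Here only the derivatives of the curl are known to be constant, so the mean value argument is
    -- used twice.
    have h1 : ∃ r : ℝ, pd c (C d) - pd d (C c) = algebraMap ℝ (Fn n) r := by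
      refine fn_const_of_pd_const fun b => ⟨r d c b - r c d b, ?_⟩
      have h2 := h23 b c d
      rw [hB c d b, hB d c b, hC d c, hC c d, pd_add, pd_add, pd_algebraMap, pd_algebraMap] at h2
      rw [map_sub, ← pdₗ_apply b, map_sub, pdₗ_apply, pdₗ_apply]
      linear_combination h2
    obtain ⟨r, hr⟩ := h1
    exact pd_sub_pd_eq_zero hr
  obtain ⟨f, r'', hf⟩ := exists_pd_add_const_of_closed (α := C) hC1
  refine ⟨f, fun a b c => r b c a, fun a b c => ?_⟩
  rw [hB b c a, hC c b, hf c, pd_add, pd_add, pd_add, pd_algebraMap, pd_algebraMap]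
  simp [← pdₗ_apply]

variable (ω : InvariantSymplecticForm n)

theorem pd_ricciForm (s : Fin (2 * n) → Fin (2 * n) → Fn n) (e a b c d : Fin (2 * n)) :
    pd e (ω.ricciForm s a b c d) = ω.ricciForm (fun c d => pd e (s c d)) a b c d := by
  simp only [InvariantSymplecticForm.ricciForm, ← pdₗ_apply, map_add, map_sub, map_smul]

/-- Exchanging `c` and `d` permutes all terms of `ricciForm` except the first, so the hypothesis
says that `ω` times the skew part of `s` vanishes. -/
theorem ricciForm_symm_of_symm (hn : 1 ≤ n) {S : Type*} [AddCommGroup S] [Module ℝ S]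
    {s : Fin (2 * n) → Fin (2 * n) → S}
    (h : ∀ a b c d, ω.ricciForm s a b c d = ω.ricciForm s a b d c) (c d : Fin (2 * n)) :
    s c d = s d c := by
  have h1 : ω.contract (fun a b => ω.mat a b • (2 : ℝ) • (s c d - s d c)) = 0 := by
    rw [← ω.contract_zero (S := S)]
    congr 1
    funext a b
    have := h a b c d
    rw [InvariantSymplecticForm.ricciForm, InvariantSymplecticForm.ricciForm] at this
    linear_combination (norm := module) this
  rw [ω.contract_form, smul_smul, smul_eq_zero, sub_eq_zero] at h1
  refine h1.resolve_left ?_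
  have : (1 : ℝ) ≤ n := by exact_mod_cast hn
  positivity

/-- The Ricci tensor of an infinitesimal deformation of Ricci type of the standard connection is
constant. -/
theorem ricci_const_of_linear (hn : 2 ≤ n) (α : Fin (2 * n) → Fin (2 * n) → Fin (2 * n) → Fn n)
    (h23 : ∀ a b c, α a b c = α a c b) (s : Fin (2 * n) → Fin (2 * n) → Fn n)
    (Q : Fin (2 * n) → Fin (2 * n) → Fin (2 * n) → Fin (2 * n) → ℝ)
    (H : ∀ a b c d, pd a (α b c d) - pd b (α a c d) + algebraMap ℝ (Fn n) (Q a b c d)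
      = ω.ricciForm s a b c d) (c d : Fin (2 * n)) :
    ∃ r : ℝ, s c d = algebraMap ℝ (Fn n) r := by
  -- One derivative removes the constant `Q`; the right-hand side then satisfies the Bianchi
  -- identity because derivatives commute.
  have H' : ∀ e a b c d, ω.ricciForm (fun c d => pd e (s c d)) a b c d
      = pd e (pd a (α b c d)) - pd e (pd b (α a c d)) := by
    intro e a b c d
    rw [← pd_ricciForm, ← H, pd_add, pd_algebraMap, add_zero, ← pdₗ_apply, map_sub]
    rfl
  obtain ⟨u, hu⟩ := ω.exists_eq_of_bianchi hn (fun e c d => pd e (s c d))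
    (fun e c d => ricciForm_symm_of_symm ω (by omega) (s := fun c d => pd e (s c d))
      (fun a b c d => by rw [H', H', h23 b, h23 a]) c d)
    (fun e a b c d => by
      rw [H', H', H', pd_comm e a, pd_comm e b, pd_comm b a]
      abel)
  have hpd : ∀ f e c d, pd f (pd e (s c d)) = ω.mat e c • pd f (u d) + ω.mat e d • pd f (u c) := by
    intro f e c d
    simp only [hu, pd_add, pd_smul]
  obtain ⟨τ, hτ⟩ := ω.exists_eq_smul_form (by omega) (fun e d => pd e (u d)) (fun f e c d => by
    have := hpd e f c d
    rw [pd_comm, hpd f e c d] at this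
    linear_combination (norm := module) -this)
  -- Commuting derivatives on `u` gives `ω_{ed} ∂_f τ = ω_{fd} ∂_e τ`, whose trace over `e` and `d`
  -- is `(2n - 1) ∂_f τ = 0`.
  have hτ0 : ∀ f, pd f τ = 0 := by
    intro f
    have h1 : ∀ e d, ω.mat e d • pd f τ = -(ω.mat d f • pd e τ) := by
      intro e d
      have h2 : pd f (pd e (u d)) = pd e (pd f (u d)) := pd_comm _ _ _
      simp only [hτ, pd_smul] at h2
      rw [h2, ω.skew f d, neg_smul]
    have h3 : ω.contract (fun e d => ω.mat e d • pd f τ + ω.mat d f • pd e τ) = 0 := by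
      simp only [h1, neg_add_cancel, InvariantSymplecticForm.contract_zero]
    rw [ω.contract_add, ω.contract_form, ω.contract_form_right] at h3
    have h4 : (2 * n - 1 : ℝ) • pd f τ = 0 := by linear_combination (norm := module) h3
    refine (smul_eq_zero.1 h4).resolve_left ?_
    have : (2 : ℝ) ≤ n := by exact_mod_cast hn
    linarith
  have hτc := fn_const_of_pd_eq_zero hτ0
  have huc : ∀ d, ∃ r : ℝ, u d = algebraMap ℝ (Fn n) r := fun d =>
    fn_const_of_pd_const fun e => by rw [hτ]; exact exists_const_smul hτc _
  exact fn_const_of_pd_const fun e => by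
    rw [hu]
    exact exists_const_add (exists_const_smul (huc d) _) (exists_const_smul (huc c) _)

/-- An infinitesimal deformation of Ricci type of the standard connection is, up to a constant
tensor, the third derivative of a function. -/
theorem exists_third_derivative_of_linear (hn : 2 ≤ n)
    (α : Fin (2 * n) → Fin (2 * n) → Fin (2 * n) → Fn n)
    (h12 : ∀ a b c, α a b c = α b a c) (h23 : ∀ a b c, α a b c = α a c b)
    (s : Fin (2 * n) → Fin (2 * n) → Fn n)
    (Q : Fin (2 * n) → Fin (2 * n) → Fin (2 * n) → Fin (2 * n) → ℝ)
    (H : ∀ a b c d, pd a (α b c d) - pd b (α a c d) + algebraMap ℝ (Fn n) (Q a b c d)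
      = ω.ricciForm s a b c d) :
    ∃ (f : Fn n) (r : Fin (2 * n) → Fin (2 * n) → Fin (2 * n) → ℝ),
      ∀ a b c, α a b c = pd a (pd b (pd c f)) + algebraMap ℝ (Fn n) (r a b c) := by
  refine exists_third_derivative α h12 h23 fun a b c d => ?_
  choose r hr using ricci_const_of_linear ω hn α h23 s Q H
  -- With `s` constant the curl of `α` is constant, hence zero by its mean.
  refine pd_sub_pd_eq_zero (r := ω.ricciForm r a b c d - Q a b c d) ?_
  rw [map_sub, eq_sub_iff_add_eq, H]
  simp only [InvariantSymplecticForm.ricciForm, hr, Algebra.smul_def, map_add, map_sub, map_mul,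
    Algebra.algebraMap_self, RingHom.id_apply]

variable {K : Type*} [CommRing K] [IsDomain K] [Algebra ℝ K]

/-- An invariant symplectic connection of Ricci type is flat. -/
theorem InvariantSymplecticForm.commute_of_const (hn : 2 ≤ n)
    (Γ : Fin (2 * n) → Matrix (Fin (2 * n)) (Fin (2 * n)) K)
    (s : Matrix (Fin (2 * n)) (Fin (2 * n)) K)
    (htor : ∀ a b c, Γ a b c = Γ b a c)
    (hα : ∀ a, (Γ a * ω.matMap K).transpose = Γ a * ω.matMap K)
    (H : ∀ a b, (Γ b * Γ a - Γ a * Γ b) * ω.matMap K = ω.ricciMat s a b) (a b : Fin (2 * n)) :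
    Γ b * Γ a - Γ a * Γ b = 0 := by
  have hW : IsUnit (ω.matMap K).det := by
    rw [matMap, ← RingHom.mapMatrix_apply, ← RingHom.map_det]
    exact ω.nondegenerate.map _
  have hΓ : ∀ e, (ω.matMap K) * (Γ e).transpose = -(Γ e * ω.matMap K) := by
    intro e
    have hWt : (ω.matMap K).transpose = -ω.matMap K := by ext a b; exact ω.matMap_skew b a
    have := hα e
    rw [Matrix.transpose_mul, hWt, neg_mul] at this
    rw [← this, neg_neg]
  -- The `Γ a` lie in the symplectic Lie algebra, which is closed under commutators; this makes `s`
  -- symmetric.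
  have hsymm : ∀ a b, (ω.ricciMat s a b).transpose = ω.ricciMat s a b := by
    intro a b
    have h1 : ∀ a b, (Γ b * Γ a * ω.matMap K).transpose = -(Γ a * Γ b * ω.matMap K) := by
      intro a b
      rw [mul_assoc, Matrix.transpose_mul, hα, mul_assoc, hΓ, mul_neg, mul_assoc]
    rw [← H, sub_mul, Matrix.transpose_sub, h1, h1]
    abel
  have hs : s.transpose = s := by
    ext c d
    exact ricciForm_symm_of_symm ω (by omega) (s := fun c d => s c d)
      (fun a b c d => congrFun (congrFun (hsymm a b) d) c) d c
  have h0 := ω.ricci_eq_zero_of_const hn Γ s hs htor hα H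
  have h1 : ω.ricciMat s a b = 0 := by
    ext c d
    rw [ricciMat_apply, h0]
    simp
  rw [← Matrix.mul_nonsing_inv_cancel_right (ω.matMap K) (Γ b * Γ a - Γ a * Γ b) hW, H, h1,
    zero_mul]

end LinearEquation

/-! ### Complete filtrations and exponentials of linear maps that raise them -/

/-- A complete separated decreasing filtration of a real vector space. -/
class Filtered (M : Type*) [AddCommGroup M] [Module ℝ M] where
  ord : ℕ → Submodule ℝ M
  ord_zero : ∀ x, x ∈ ord 0
  anti : Antitone ord
  separated : ∀ x, (∀ m, x ∈ ord m) → x = 0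
  complete : ∀ s : ℕ → M, (∀ j, s j ∈ ord j) → ∃ y, ∀ m, y - ∑ j ∈ Finset.range m, s j ∈ ord m

open Filtered

instance {A : Type*} [CommRing A] [Algebra ℝ A] : Filtered (PowerSeries A) where
  ord m :=
    { carrier := {f | ∀ i < m, PowerSeries.coeff i f = 0}
      add_mem' := fun {f g} hf hg i hi => by rw [map_add, hf i hi, hg i hi, add_zero]
      zero_mem' := fun i _ => map_zero _
      smul_mem' := fun r f hf i hi => by
        rw [PowerSeries.coeff_smul, hf i hi, smul_zero] }
  ord_zero := fun x i hi => absurd hi (Nat.not_lt_zero i)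
  anti := fun m k hmk f hf i hi => hf i (hi.trans_le hmk)
  separated := fun f hf => PowerSeries.ext fun i => by rw [hf (i + 1) i i.lt_succ_self, map_zero]
  complete := fun s hs => by
    refine ⟨PowerSeries.mk fun i => ∑ j ∈ Finset.range (i + 1), PowerSeries.coeff i (s j),
      fun m i hi => ?_⟩
    rw [map_sub, PowerSeries.coeff_mk, map_sum, sub_eq_zero]
    refine Finset.sum_subset (Finset.range_mono hi) fun j _ hj => ?_
    exact hs j i (by simpa using hj)

instance {ι M : Type*} [AddCommGroup M] [Module ℝ M] [Filtered M] : Filtered (ι → M) where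
  ord m := Submodule.pi Set.univ fun _ => ord m
  ord_zero := fun x i _ => ord_zero (x i)
  anti := fun m k hmk x hx i hi => anti hmk (hx i hi)
  separated := fun x hx => funext fun i => separated _ fun m => hx m i trivial
  complete := fun s hs => by
    choose y hy using fun i => complete (fun j => s j i) fun j => hs j i trivial
    exact ⟨y, fun m i _ => by simpa using hy i m⟩

theorem mem_ord_pi {ι M : Type*} [AddCommGroup M] [Module ℝ M] [Filtered M] {x : ι → M} {m : ℕ} :
    x ∈ (ord m : Submodule ℝ (ι → M)) ↔ ∀ i, x i ∈ (ord m : Submodule ℝ M) := by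
  change x ∈ Submodule.pi _ _ ↔ _
  simp [Submodule.mem_pi]

section

variable {M : Type*} [AddCommGroup M] [Module ℝ M] [Filtered M]

theorem eq_of_sub_mem_ord {x y : M} (h : ∀ m, x - y ∈ ord (M := M) m) : x = y :=
  sub_eq_zero.1 (separated _ h)

/-- The sum of a series whose `j`-th term lies in the `j`-th step of the filtration. -/
def limSum (s : ℕ → M) (hs : ∀ j, s j ∈ ord (M := M) j) : M := (complete s hs).choose

theorem limSum_sub_mem (s : ℕ → M) (hs : ∀ j, s j ∈ ord (M := M) j) (m : ℕ) :
    limSum s hs - ∑ j ∈ Finset.range m, s j ∈ ord (M := M) m :=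
  (complete s hs).choose_spec m

theorem eq_limSum {s : ℕ → M} {hs : ∀ j, s j ∈ ord (M := M) j} {y : M}
    (h : ∀ m, y - ∑ j ∈ Finset.range m, s j ∈ ord (M := M) m) : y = limSum s hs :=
  eq_of_sub_mem_ord fun m => by
    simpa using Submodule.sub_mem _ (h m) (limSum_sub_mem s hs m)

/-- An additive map which is the identity to leading order is bijective. -/
theorem bijective_of_sub_mem (F : M →ₗ[ℝ] M)
    (h : ∀ m, ∀ x ∈ ord (M := M) m, F x - x ∈ ord (M := M) (m + 1)) : Function.Bijective F := by
  have hF : ∀ m, ∀ x ∈ ord (M := M) m, F x ∈ ord (M := M) m := fun m x hx => by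
    simpa using Submodule.add_mem _ (anti (Nat.le_succ m) (h m x hx)) hx
  refine ⟨(injective_iff_map_eq_zero F).2 fun x hx => separated _ fun m => ?_, fun y => ?_⟩
  · induction m with
    | zero => exact ord_zero x
    | succ m ih => simpa [hx] using h m x ih
  -- A preimage of `y` by the Neumann series for the inverse of `F`.
  · set r : ℕ → M := fun j => ((LinearMap.id - F : M →ₗ[ℝ] M) ^ j) y with hr
    have hr1 : ∀ j, r (j + 1) = r j - F (r j) := fun j => by
      simp only [hr, pow_succ', Module.End.mul_apply]
      rfl
    have hr2 : ∀ j, r j ∈ ord (M := M) j := by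
      intro j
      induction j with
      | zero => exact ord_zero _
      | succ j ih => rw [hr1, ← neg_sub]; exact Submodule.neg_mem _ (h j _ ih)
    refine ⟨limSum r hr2, eq_of_sub_mem_ord fun m => ?_⟩
    have h1 : F (∑ j ∈ Finset.range m, r j) = y - r m := by
      have h2 : ∀ j, F (r j) = r j - r (j + 1) := fun j => by rw [hr1]; abel
      rw [map_sum, Finset.sum_congr rfl fun j _ => h2 j, Finset.sum_range_sub']
      simp [hr]
    have h3 := hF m _ (limSum_sub_mem r hr2 m)
    rw [map_sub, h1] at h3
    have h4 := Submodule.sub_mem _ h3 (hr2 m)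
    rwa [sub_sub, sub_add_cancel] at h4

/-- A linear map which raises the filtration by `k`. -/
def Raises (k : ℕ) (N : M →ₗ[ℝ] M) : Prop := ∀ m, ∀ x ∈ ord (M := M) m, N x ∈ ord (M := M) (m + k)

theorem Raises.pow {N : M →ₗ[ℝ] M} (hN : Raises 1 N) (j m : ℕ) {x : M} (hx : x ∈ ord (M := M) m) :
    (N ^ j) x ∈ ord (M := M) (m + j) := by
  induction j with
  | zero => simpa using hx
  | succ j ih => rw [pow_succ', Module.End.mul_apply]; exact hN _ _ ih

end

section

variable {M : Type*} [AddCommGroup M] [Module ℝ M]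

/-- The divided powers `N^j / j!`. -/
def dpow (N : M →ₗ[ℝ] M) (j : ℕ) (x : M) : M := (j.factorial : ℝ)⁻¹ • (N ^ j) x

theorem dpow_zero (N : M →ₗ[ℝ] M) (x : M) : dpow N 0 x = x := by simp [dpow]

theorem dpow_one (N : M →ₗ[ℝ] M) (x : M) : dpow N 1 x = N x := by simp [dpow]

theorem map_dpow (N : M →ₗ[ℝ] M) (j : ℕ) (x : M) :
    N (dpow N j x) = ((j + 1 : ℕ) : ℝ) • dpow N (j + 1) x := by
  have h : ((j + 1 : ℕ) : ℝ) ≠ 0 := by positivity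
  rw [dpow, dpow, map_smul, smul_smul, Nat.factorial_succ, Nat.cast_mul, mul_inv,
    mul_inv_cancel_left₀ h, pow_succ', Module.End.mul_apply]

variable [Filtered M]

theorem Raises.dpow_mem {N : M →ₗ[ℝ] M} (hN : Raises 1 N) (j m : ℕ) {x : M}
    (hx : x ∈ ord (M := M) m) : dpow N j x ∈ ord (M := M) (m + j) :=
  Submodule.smul_mem _ _ (hN.pow j m hx)

theorem Raises.dpow_mem' {N : M →ₗ[ℝ] M} (hN : Raises 1 N) (x : M) (j : ℕ) :
    dpow N j x ∈ ord (M := M) j := by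
  simpa using hN.dpow_mem j 0 (ord_zero x)

/-- The exponential of a linear map raising the filtration. -/
def fexp (N : M →ₗ[ℝ] M) (hN : Raises 1 N) : M →ₗ[ℝ] M where
  toFun x := limSum (fun j => dpow N j x) (hN.dpow_mem' x)
  map_add' x y := by
    refine (eq_limSum fun m => ?_).symm
    have := Submodule.add_mem _ (limSum_sub_mem _ (hN.dpow_mem' x) m)
      (limSum_sub_mem _ (hN.dpow_mem' y) m)
    rw [sub_add_sub_comm, ← Finset.sum_add_distrib] at this
    simpa [dpow] using this
  map_smul' r x := by
    refine (eq_limSum fun m => ?_).symm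
    have := Submodule.smul_mem _ r (limSum_sub_mem _ (hN.dpow_mem' x) m)
    rw [smul_sub, Finset.smul_sum] at this
    simpa [dpow, smul_comm r] using this

variable {N : M →ₗ[ℝ] M} (hN : Raises 1 N)

theorem fexp_sub_sum_mem (x : M) (m : ℕ) :
    fexp N hN x - ∑ j ∈ Finset.range m, dpow N j x ∈ ord (M := M) m :=
  limSum_sub_mem _ (hN.dpow_mem' x) m

theorem fexp_sub_mem (m : ℕ) (x : M) (hx : x ∈ ord (M := M) m) :
    fexp N hN x - x ∈ ord (M := M) (m + 1) := by
  have h1 := fexp_sub_sum_mem hN x (m + 1)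
  rw [Finset.sum_range_succ', dpow_zero] at h1
  have h2 : ∑ j ∈ Finset.range m, dpow N (j + 1) x ∈ ord (M := M) (m + 1) :=
    Submodule.sum_mem _ fun j _ => anti (by omega) (hN.dpow_mem (j + 1) m hx)
  have h3 := Submodule.add_mem _ h1 h2
  rwa [show fexp N hN x - (∑ j ∈ Finset.range m, dpow N (j + 1) x + x)
    + ∑ j ∈ Finset.range m, dpow N (j + 1) x = fexp N hN x - x by abel] at h3

theorem fexp_mem (m : ℕ) (x : M) (hx : x ∈ ord (M := M) m) : fexp N hN x ∈ ord (M := M) m := by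
  simpa using Submodule.add_mem _ (anti (Nat.le_succ m) (fexp_sub_mem hN m x hx)) hx

theorem fexp_bijective : Function.Bijective (fexp N hN) :=
  bijective_of_sub_mem _ (fexp_sub_mem hN)

theorem fexp_eq_self {x : M} (hx : N x = 0) : fexp N hN x = x := by
  refine (eq_limSum (hs := hN.dpow_mem' x) fun m => ?_).symm
  cases m with
  | zero => exact ord_zero _
  | succ m =>
    have : ∀ j, dpow N (j + 1) x = 0 := fun j => by
      rw [dpow, pow_succ, Module.End.mul_apply, hx, map_zero, smul_zero]
    simp [Finset.sum_range_succ', this, dpow_zero]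

/-- In the expansion of `(N + G)^j - N^j` each term contains `G` at least once, which gives `k`, and
`j - 1` further factors of order at least one. Modulo order `k + 1` only `j = 1` survives, whether
or not `N` and `G` commute. -/
theorem fexp_add_sub_mem {G : M →ₗ[ℝ] M} {k : ℕ} (hk : 1 ≤ k) (hG : Raises k G)
    (hNG : Raises 1 (N + G)) (x : M) :
    fexp (N + G) hNG x - fexp N hN x - G x ∈ ord (M := M) (k + 1) := by
  have h1 : ∀ j, ((N + G) ^ (j + 1)) x - (N ^ (j + 1)) x ∈ ord (M := M) (k + j) := by
    intro j
    induction j with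
    | zero => simpa using hG 0 x (ord_zero x)
    | succ j ih =>
      have h2 := Submodule.add_mem _ (hNG _ _ ih)
        (anti (by omega) (hG _ _ (hN.pow (j + 1) 0 (ord_zero x))) :
          G ((N ^ (j + 1)) x) ∈ ord (M := M) (k + j + 1))
      rw [pow_succ' (N + G) (j + 1), pow_succ' N (j + 1), Module.End.mul_apply,
        Module.End.mul_apply]
      rw [map_sub, LinearMap.add_apply N G ((N ^ (j + 1)) x)] at h2
      have h3 : ∀ a b c : M, a - (b + c) + c = a - b := fun a b c => by abel
      rwa [h3] at h2
  have h2 := Submodule.sub_mem _ (fexp_sub_sum_mem hNG x (k + 1)) (fexp_sub_sum_mem hN x (k + 1))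
  have h3 : ∑ j ∈ Finset.range (k + 1), dpow (N + G) j x - ∑ j ∈ Finset.range (k + 1), dpow N j x
      - G x ∈ ord (M := M) (k + 1) := by
    obtain ⟨l, rfl⟩ := Nat.exists_eq_add_of_le' hk
    rw [← Finset.sum_sub_distrib, Finset.sum_range_succ', Finset.sum_range_succ', dpow_zero,
      dpow_zero, dpow_one, dpow_one, LinearMap.add_apply]
    have : ∀ z : M, z + (N x + G x - N x) + (x - x) - G x = z := fun z => by abel
    rw [this]
    refine Submodule.sum_mem _ fun j _ => ?_
    rw [dpow, dpow, ← smul_sub]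
    exact Submodule.smul_mem _ _ (anti (by omega) (h1 (j + 1)))
  have h4 := Submodule.add_mem _ h2 h3
  convert h4 using 1
  abel

theorem fexp_sub_sub_mem {N' G : M →ₗ[ℝ] M} (hN' : Raises 1 N') (e : N' = N + G) {k : ℕ}
    (hk : 1 ≤ k) (hG : Raises k G) (x : M) :
    fexp N' hN' x - fexp N hN x - G x ∈ ord (M := M) (k + 1) := by
  subst e
  exact fexp_add_sub_mem hN hk hG hN' x

end

/-! ### Exponentials of derivations respect bilinear operations -/

section Bilinear

set_option linter.unusedSectionVars false

variable {M₁ M₂ M₃ : Type*} [AddCommGroup M₁] [Module ℝ M₁] [Filtered M₁]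
  [AddCommGroup M₂] [Module ℝ M₂] [Filtered M₂] [AddCommGroup M₃] [Module ℝ M₃] [Filtered M₃]
  {B : M₁ →ₗ[ℝ] M₂ →ₗ[ℝ] M₃}

theorem sum_mul_antidiagonal_fst (F : ℕ → ℕ → M₃) (k : ℕ) :
    ∑ p ∈ Finset.HasAntidiagonal.antidiagonal (k + 1), (p.1 : ℝ) • F p.1 p.2
      = ∑ p ∈ Finset.HasAntidiagonal.antidiagonal k, ((p.1 + 1 : ℕ) : ℝ) • F (p.1 + 1) p.2 := by
  rw [Finset.Nat.sum_antidiagonal_succ]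
  simp

theorem sum_mul_antidiagonal_snd (F : ℕ → ℕ → M₃) (k : ℕ) :
    ∑ p ∈ Finset.HasAntidiagonal.antidiagonal (k + 1), (p.2 : ℝ) • F p.1 p.2
      = ∑ p ∈ Finset.HasAntidiagonal.antidiagonal k, ((p.2 + 1 : ℕ) : ℝ) • F p.1 (p.2 + 1) := by
  rw [Finset.Nat.sum_antidiagonal_succ']
  simp

/-- The Leibniz formula in divided powers, free of binomials. In the induction the factor `k + 1` is
split as `p.1 + p.2`, each part absorbed by `map_dpow`. -/
theorem dpow_bilinear {N₁ : M₁ →ₗ[ℝ] M₁} {N₂ : M₂ →ₗ[ℝ] M₂} {N₃ : M₃ →ₗ[ℝ] M₃}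
    (hL : ∀ x y, N₃ (B x y) = B (N₁ x) y + B x (N₂ y)) (x : M₁) (y : M₂) (k : ℕ) :
    dpow N₃ k (B x y) = ∑ p ∈ Finset.HasAntidiagonal.antidiagonal k, B (dpow N₁ p.1 x) (dpow N₂ p.2 y) := by
  induction k with
  | zero => simp [dpow_zero]
  | succ k ih =>
    have h : ((k + 1 : ℕ) : ℝ) • dpow N₃ (k + 1) (B x y) = ((k + 1 : ℕ) : ℝ) •
        ∑ p ∈ Finset.HasAntidiagonal.antidiagonal (k + 1), B (dpow N₁ p.1 x) (dpow N₂ p.2 y) := by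
      have h1 : ∀ p ∈ Finset.HasAntidiagonal.antidiagonal (k + 1), ((k + 1 : ℕ) : ℝ) •
          B (dpow N₁ p.1 x) (dpow N₂ p.2 y) = (p.1 : ℝ) • B (dpow N₁ p.1 x) (dpow N₂ p.2 y)
            + (p.2 : ℝ) • B (dpow N₁ p.1 x) (dpow N₂ p.2 y) := by
        intro p hp
        rw [← Finset.HasAntidiagonal.mem_antidiagonal.1 hp, Nat.cast_add, add_smul]
      rw [← map_dpow, ih, map_sum, Finset.smul_sum, Finset.sum_congr rfl h1,
        Finset.sum_add_distrib, sum_mul_antidiagonal_fst fun i j => B (dpow N₁ i x) (dpow N₂ j y),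
        sum_mul_antidiagonal_snd fun i j => B (dpow N₁ i x) (dpow N₂ j y),
        ← Finset.sum_add_distrib]
      refine Finset.sum_congr rfl fun p _ => ?_
      rw [hL, map_dpow, map_dpow, map_smul, map_smul, LinearMap.smul_apply]
    exact smul_right_injective M₃ (by positivity : ((k + 1 : ℕ) : ℝ) ≠ 0) h

/-- The source of the naturality statements for products, module structure, action of fields, `ω`,
Lie and Poisson brackets: each is a bilinear map with an infinitesimal Leibniz rule. -/
theorem fexp_bilinear (hB : ∀ i j, ∀ x ∈ ord (M := M₁) i, ∀ y ∈ ord (M := M₂) j,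
      B x y ∈ ord (M := M₃) (i + j))
    {N₁ : M₁ →ₗ[ℝ] M₁} {N₂ : M₂ →ₗ[ℝ] M₂} {N₃ : M₃ →ₗ[ℝ] M₃}
    (h₁ : Raises 1 N₁) (h₂ : Raises 1 N₂) (h₃ : Raises 1 N₃)
    (hL : ∀ x y, N₃ (B x y) = B (N₁ x) y + B x (N₂ y)) (x : M₁) (y : M₂) :
    fexp N₃ h₃ (B x y) = B (fexp N₁ h₁ x) (fexp N₂ h₂ y) := by
  refine (eq_limSum (hs := h₃.dpow_mem' (B x y)) fun m => ?_).symm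
  set X := ∑ j ∈ Finset.range m, dpow N₁ j x
  set Y := ∑ j ∈ Finset.range m, dpow N₂ j y
  have e1 : B (fexp N₁ h₁ x - X) (fexp N₂ h₂ y) ∈ ord (M := M₃) m := 
    hB m 0 _ (fexp_sub_sum_mem h₁ x m) _ (ord_zero _)
  have e2 : B X (fexp N₂ h₂ y - Y) ∈ ord (M := M₃) m := by
    have := hB 0 m X (ord_zero _) _ (fexp_sub_sum_mem h₂ y m)
    rwa [zero_add] at this
  have e3 : B X Y - ∑ k ∈ Finset.range m, dpow N₃ k (B x y) ∈ ord (M := M₃) m := by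
    -- The exponential truncated at `m` is the triangle `i + j < m` inside the square occurring in
    -- `B X Y`; the terms outside the triangle have order at least `m`.
    have h4 : ∑ k ∈ Finset.range m, dpow N₃ k (B x y)
        = ∑ p ∈ (Finset.range m ×ˢ Finset.range m) with p.1 + p.2 < m,
          B (dpow N₁ p.1 x) (dpow N₂ p.2 y) := by
      simp_rw [dpow_bilinear hL]
      rw [Finset.sum_sigma']
      refine Finset.sum_bij' (fun a _ => a.2) (fun p _ => ⟨p.1 + p.2, p⟩) ?_ ?_ ?_ ?_ ?_
      · rintro ⟨k, i, j⟩ h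
        simp only [Finset.mem_sigma, Finset.mem_range, Finset.HasAntidiagonal.mem_antidiagonal] at h
        simp only [Finset.mem_filter, Finset.mem_product, Finset.mem_range]
        omega
      · rintro ⟨i, j⟩ h
        simp only [Finset.mem_filter, Finset.mem_product, Finset.mem_range] at h
        simp only [Finset.mem_sigma, Finset.mem_range, Finset.HasAntidiagonal.mem_antidiagonal]
        exact ⟨h.2, trivial⟩
      · rintro ⟨k, i, j⟩ h
        simp only [Finset.mem_sigma, Finset.mem_range, Finset.HasAntidiagonal.mem_antidiagonal] at h
        obtain ⟨-, rfl⟩ := h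
        rfl
      · intros; rfl
      · intros; rfl
    have h5 : B X Y = ∑ p ∈ (Finset.range m ×ˢ Finset.range m),
        B (dpow N₁ p.1 x) (dpow N₂ p.2 y) := by
      simp only [X, Y, map_sum, LinearMap.sum_apply, Finset.sum_product]
      exact Finset.sum_comm
    rw [h5, h4, ← Finset.sum_filter_add_sum_filter_not _ (fun p => p.1 + p.2 < m),
      add_sub_cancel_left]
    refine Submodule.sum_mem _ fun p hp => ?_
    rw [Finset.mem_filter, not_lt] at hp
    exact anti hp.2 (hB _ _ _ (h₁.dpow_mem' x _) _ (h₂.dpow_mem' y _))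
  have h6 := Submodule.add_mem _ (Submodule.add_mem _ e1 e2) e3
  convert h6 using 1
  rw [map_sub, map_sub, LinearMap.sub_apply]
  abel

end Bilinear

/-! ### Formal vector fields, Hamiltonian fields and their Leibniz rules -/

section VectorFields

open Filtered

variable {n : ℕ}

theorem coeff_fpd (a : Fin (2 * n)) (f : FormalFn n) (k : ℕ) :
    PowerSeries.coeff k (fpd a f) = pd a (PowerSeries.coeff k f) := PowerSeries.coeff_mk _ _

/-- The `ℝ`-linear map underlying `fpd`. -/
def fpdₗ (a : Fin (2 * n)) : FormalFn n →ₗ[ℝ] FormalFn n where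
  toFun := fpd a
  map_add' f g := PowerSeries.ext fun k => by simp only [coeff_fpd, map_add, pd_add]
  map_smul' r f := PowerSeries.ext fun k => by
    simp only [coeff_fpd, PowerSeries.coeff_smul, pd_smul, RingHom.id_apply]

theorem fpd_add (a : Fin (2 * n)) (f g : FormalFn n) : fpd a (f + g) = fpd a f + fpd a g :=
  map_add (fpdₗ a) f g

theorem fpd_smul (a : Fin (2 * n)) (r : ℝ) (f : FormalFn n) : fpd a (r • f) = r • fpd a f :=
  map_smul (fpdₗ a) r f

theorem fpd_sum {ι : Type*} (a : Fin (2 * n)) (s : Finset ι) (f : ι → FormalFn n) :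
    fpd a (∑ i ∈ s, f i) = ∑ i ∈ s, fpd a (f i) := map_sum (fpdₗ a) f s

theorem fpd_mul (a : Fin (2 * n)) (f g : FormalFn n) :
    fpd a (f * g) = fpd a f * g + f * fpd a g := by
  ext1 k
  simp only [coeff_fpd, map_add, PowerSeries.coeff_mul, ← Finset.sum_add_distrib]
  rw [← pdₗ_apply, map_sum]
  exact Finset.sum_congr rfl fun p _ => pd_mul _ _ _

theorem fpd_comm (a b : Fin (2 * n)) (f : FormalFn n) : fpd a (fpd b f) = fpd b (fpd a f) :=
  PowerSeries.ext fun k => by simp only [coeff_fpd, pd_comm a b]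

theorem fpd_one (a : Fin (2 * n)) : fpd a (1 : FormalFn n) = 0 := by
  have h := fpd_mul a (1 : FormalFn n) 1
  rw [mul_one, mul_one, one_mul] at h
  exact left_eq_add.1 h

theorem fpd_X (a : Fin (2 * n)) : fpd a (PowerSeries.X : FormalFn n) = 0 := by
  ext1 k
  rw [coeff_fpd, PowerSeries.coeff_X, map_zero]
  split_ifs
  · simpa using pd_algebraMap a (1 : ℝ)
  · simpa using pd_algebraMap a (0 : ℝ)

namespace FormalVF

theorem act_add_left (X Y : FormalVF n) (f : FormalFn n) : (X + Y).act f = X.act f + Y.act f := by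
  simp only [act, Pi.add_apply, add_mul, Finset.sum_add_distrib]

theorem act_smul_left (g : FormalFn n) (X : FormalVF n) (f : FormalFn n) :
    act (g • X) f = g * X.act f := by
  simp only [act, Pi.smul_apply, smul_eq_mul, mul_assoc, Finset.mul_sum]

theorem act_add_right (X : FormalVF n) (f g : FormalFn n) : X.act (f + g) = X.act f + X.act g := by
  simp only [act, fpd_add, mul_add, Finset.sum_add_distrib]

/-- The action of vector fields on functions as a bilinear map. -/
def actₗ : FormalVF n →ₗ[ℝ] FormalFn n →ₗ[ℝ] FormalFn n :=
  LinearMap.mk₂ ℝ act act_add_left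
    (fun r X f => by simp only [act, Pi.smul_apply, smul_mul_assoc, Finset.smul_sum])
    act_add_right
    (fun r X f => by simp only [act, fpd_smul, mul_smul_comm, Finset.smul_sum])

theorem actₗ_apply (X : FormalVF n) (f : FormalFn n) : actₗ X f = X.act f := rfl

theorem act_mul (X : FormalVF n) (f g : FormalFn n) :
    X.act (f * g) = X.act f * g + f * X.act g := by
  simp only [act, fpd_mul, Finset.sum_mul, Finset.mul_sum, ← Finset.sum_add_distrib]
  exact Finset.sum_congr rfl fun a _ => by ring

theorem act_sub_right (X : FormalVF n) (f g : FormalFn n) : X.act (f - g) = X.act f - X.act g :=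
  map_sub (actₗ X) f g

theorem act_zero_right (X : FormalVF n) : X.act 0 = 0 := map_zero (actₗ X)

theorem act_smul_right (X : FormalVF n) (r : ℝ) (f : FormalFn n) : X.act (r • f) = r • X.act f :=
  map_smul (actₗ X) r f

theorem act_sum_right {ι : Type*} (X : FormalVF n) (s : Finset ι) (f : ι → FormalFn n) :
    X.act (∑ i ∈ s, f i) = ∑ i ∈ s, X.act (f i) := map_sum (actₗ X) f s

theorem act_one (X : FormalVF n) : X.act 1 = 0 := by simp [act, fpd_one]

theorem act_frame (a : Fin (2 * n)) (f : FormalFn n) : (frame a).act f = fpd a f := by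
  simp [act, frame, Pi.single_apply]

theorem act_frame_apply (X : FormalVF n) (a c : Fin (2 * n)) : X.act (frame a c) = 0 := by
  by_cases h : c = a
  · subst h
    simpa [frame] using act_one X
  · simp [frame, h, act_zero_right]

theorem bracket_frame (a b : Fin (2 * n)) : bracket (frame a : FormalVF n) (frame b) = 0 := by
  funext c
  simp [bracket, act_frame_apply]

theorem eq_sum_frame (X : FormalVF n) : X = ∑ a, X a • frame a := by
  funext c
  simp [frame, Finset.sum_apply, Pi.single_apply]

theorem act_bracket (X Y : FormalVF n) (f : FormalFn n) :
    (X.bracket Y).act f = X.act (Y.act f) - Y.act (X.act f) := by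
  have h : ∀ X Y : FormalVF n, X.act (Y.act f)
      = ∑ c, X.act (Y c) * fpd c f + ∑ c, ∑ a, X a * Y c * fpd a (fpd c f) := by
    intro X Y
    conv_lhs => rw [act.eq_1 Y f]
    rw [act_sum_right, ← Finset.sum_add_distrib]
    refine Finset.sum_congr rfl fun c _ => ?_
    rw [act_mul, act.eq_1 X (fpd c f), Finset.mul_sum]
    congr 1
    exact Finset.sum_congr rfl fun a _ => by ring
  have h2 : ∑ c, ∑ a, X a * Y c * fpd a (fpd c f) = ∑ c, ∑ a, Y a * X c * fpd a (fpd c f) := by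
    rw [Finset.sum_comm]
    refine Finset.sum_congr rfl fun c _ => Finset.sum_congr rfl fun a _ => ?_
    rw [fpd_comm, mul_comm (X c)]
  rw [h X Y, h Y X, h2, act]
  simp only [bracket, sub_mul, Finset.sum_sub_distrib]
  ring

theorem bracket_add_left (X Y Z : FormalVF n) :
    (X + Y).bracket Z = X.bracket Z + Y.bracket Z := by
  funext c
  simp only [bracket, Pi.add_apply, act_add_left, act_add_right]
  ring

theorem bracket_add_right (X Y Z : FormalVF n) :
    X.bracket (Y + Z) = X.bracket Y + X.bracket Z := by
  funext c
  simp only [bracket, Pi.add_apply, act_add_left, act_add_right]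
  ring

/-- The Lie bracket as a bilinear map. -/
def bracketₗ : FormalVF n →ₗ[ℝ] FormalVF n →ₗ[ℝ] FormalVF n :=
  LinearMap.mk₂ ℝ bracket bracket_add_left
    (fun r X Y => by
      funext c
      simp only [bracket, Pi.smul_apply, ← actₗ_apply, map_smul, LinearMap.smul_apply, smul_sub])
    bracket_add_right
    (fun r X Y => by
      funext c
      simp only [bracket, Pi.smul_apply, ← actₗ_apply, map_smul, LinearMap.smul_apply, smul_sub])

theorem bracketₗ_apply (X Y : FormalVF n) : bracketₗ X Y = X.bracket Y := rfl

theorem bracket_swap (X Y : FormalVF n) : X.bracket Y = -Y.bracket X := by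
  funext c
  simp [bracket]

theorem bracket_smul_right (X : FormalVF n) (f : FormalFn n) (Y : FormalVF n) :
    X.bracket (f • Y) = X.act f • Y + f • X.bracket Y := by
  funext c
  simp only [bracket, Pi.add_apply, Pi.smul_apply, smul_eq_mul, act_smul_left, act_mul]
  ring

theorem bracket_bracket (H X Y : FormalVF n) :
    H.bracket (X.bracket Y) = (H.bracket X).bracket Y + X.bracket (H.bracket Y) := by
  funext c
  rw [Pi.add_apply, bracket.eq_1 H, bracket.eq_1 (H.bracket X), bracket.eq_1 X (H.bracket Y)]
  simp only [act_bracket]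
  simp only [bracket, act_sub_right]
  ring

end FormalVF

open FormalVF

variable (ω : InvariantSymplecticForm n)

namespace InvariantSymplecticForm

theorem app_add_left (X Y Z : FormalVF n) : ω.app (X + Y) Z = ω.app X Z + ω.app Y Z := by
  simp only [app, Pi.add_apply, add_mul, smul_add, Finset.sum_add_distrib]

theorem app_add_right (X Y Z : FormalVF n) : ω.app X (Y + Z) = ω.app X Y + ω.app X Z := by
  simp only [app, Pi.add_apply, mul_add, smul_add, Finset.sum_add_distrib]

/-- The symplectic form as a bilinear map on vector fields. -/
def appₗ : FormalVF n →ₗ[ℝ] FormalVF n →ₗ[ℝ] FormalFn n :=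
  LinearMap.mk₂ ℝ ω.app ω.app_add_left
    (fun r X Y => by
      simp only [app, Pi.smul_apply, smul_mul_assoc, Finset.smul_sum, smul_comm r])
    ω.app_add_right
    (fun r X Y => by
      simp only [app, Pi.smul_apply, mul_smul_comm, Finset.smul_sum, smul_comm r])

theorem appₗ_apply (X Y : FormalVF n) : ω.appₗ X Y = ω.app X Y := rfl

theorem app_smul_right (f : FormalFn n) (X Y : FormalVF n) : ω.app X (f • Y) = f * ω.app X Y := by
  simp only [app, Pi.smul_apply, smul_eq_mul, mul_left_comm, Finset.mul_sum, mul_smul_comm]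

theorem app_frame_right (X : FormalVF n) (d : Fin (2 * n)) :
    ω.app X (frame d) = ∑ a, ω.mat a d • X a := by
  simp [app, frame, Pi.single_apply]

theorem app_swap (X Y : FormalVF n) : ω.app X Y = -ω.app Y X := by
  rw [app, Finset.sum_comm, app, ← Finset.sum_neg_distrib]
  refine Finset.sum_congr rfl fun a _ => ?_
  rw [← Finset.sum_neg_distrib]
  refine Finset.sum_congr rfl fun b _ => ?_
  rw [ω.skew a b, neg_smul, neg_neg, mul_comm]

theorem app_eq_sum_right (X Y : FormalVF n) : ω.app X Y = ∑ b, Y b * ω.app X (frame b) := by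
  conv_lhs => rw [eq_sum_frame Y]
  change ω.appₗ X _ = _
  rw [map_sum]
  exact Finset.sum_congr rfl fun b _ => ω.app_smul_right _ _ _

theorem eq_of_app_frame_eq {X Y : FormalVF n} (h : ∀ d, ω.app X (frame d) = ω.app Y (frame d)) :
    X = Y := by
  refine sub_eq_zero.1 (ω.eq_zero_of_sum_form_eq_zero fun b => ?_)
  simp only [Pi.sub_apply, smul_sub, Finset.sum_sub_distrib, ← app_frame_right, h, sub_self]

theorem app_hamiltonian_frame (f : FormalFn n) (b : Fin (2 * n)) :
    ω.app (ω.hamiltonian f) (frame b) = fpd b f := by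
  rw [app_frame_right]
  simp only [hamiltonian, Finset.smul_sum, smul_smul]
  rw [Finset.sum_comm]
  simp only [← Finset.sum_smul, mul_comm (ω.mat _ _), inv_mul_mat]
  simp

theorem app_hamiltonian (f : FormalFn n) (Y : FormalVF n) :
    ω.app (ω.hamiltonian f) Y = Y.act f := by
  simp only [ω.app_eq_sum_right _ Y, app_hamiltonian_frame, act]

theorem act_app (H X Y : FormalVF n) : H.act (ω.app X Y)
    = ω.app (fun a => H.act (X a)) Y + ω.app X (fun b => H.act (Y b)) := by
  simp only [app, act_sum_right, act_smul_right, act_mul, smul_add, Finset.sum_add_distrib]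

/-- `ω` has zero Lie derivative along a Hamiltonian field: as `ω` is constant, the defect is the
Hessian of `h` antisymmetrised in `X` and `Y`. -/
theorem hamiltonian_act_app (h : FormalFn n) (X Y : FormalVF n) :
    (ω.hamiltonian h).act (ω.app X Y)
      = ω.app ((ω.hamiltonian h).bracket X) Y + ω.app X ((ω.hamiltonian h).bracket Y) := by
  set H := ω.hamiltonian h with hH
  have h1 : ∀ X, H.bracket X = (fun a => H.act (X a)) - fun a => X.act (H a) := fun X => rfl
  have h2 : ∀ X Y : FormalVF n, ω.app (fun a => X.act (H a)) Y
      = ∑ b, ∑ c, X c * Y b * fpd c (fpd b h) := by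
    intro X Y
    rw [app_eq_sum_right]
    refine Finset.sum_congr rfl fun b _ => ?_
    have : ω.app (fun a => X.act (H a)) (frame b) = X.act (fpd b h) := by
      rw [← app_hamiltonian_frame ω h b, app_frame_right, app_frame_right, act_sum_right]
      simp only [act_smul_right, hH]
    rw [this, act, Finset.mul_sum]
    exact Finset.sum_congr rfl fun c _ => by ring
  have h3 : ω.app (fun a => X.act (H a)) Y + ω.app X (fun a => Y.act (H a)) = 0 := by
    rw [ω.app_swap X, h2, h2, Finset.sum_comm, add_neg_eq_zero]
    refine Finset.sum_congr rfl fun c _ => Finset.sum_congr rfl fun a _ => ?_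
    rw [fpd_comm, mul_comm (X c)]
  have h4 : ∀ X Y Z, ω.app (X - Y) Z = ω.app X Z - ω.app Y Z := fun X Y Z => by
    change ω.appₗ (X - Y) Z = ω.appₗ X Z - ω.appₗ Y Z
    rw [map_sub, LinearMap.sub_apply]
  have h5 : ∀ X Y Z, ω.app X (Y - Z) = ω.app X Y - ω.app X Z := fun X Y Z =>
    map_sub (ω.appₗ X) Y Z
  rw [h1, h1, h4, h5, act_app]
  linear_combination h3

theorem hamiltonian_fpoisson (h f : FormalFn n) :
    ω.hamiltonian (ω.fpoisson h f) = (ω.hamiltonian h).bracket (ω.hamiltonian f) := by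
  refine ω.eq_of_app_frame_eq fun d => ?_
  have h1 := ω.hamiltonian_act_app h (ω.hamiltonian f) (frame d)
  rw [app_hamiltonian_frame, app_hamiltonian, act_bracket, act_frame, act_frame] at h1
  rw [app_hamiltonian_frame, fpoisson]
  linear_combination h1

/-- The Hamiltonian vector field as a linear map. -/
def hamiltonianₗ : FormalFn n →ₗ[ℝ] FormalVF n where
  toFun := ω.hamiltonian
  map_add' f g := by
    funext a
    simp only [hamiltonian, fpd_add, smul_add, Finset.sum_add_distrib, Pi.add_apply]
  map_smul' r f := by
    funext a
    simp only [hamiltonian, fpd_smul, Finset.smul_sum, smul_comm r, Pi.smul_apply,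
      RingHom.id_apply]

theorem hamiltonian_add (f g : FormalFn n) :
    ω.hamiltonian (f + g) = ω.hamiltonian f + ω.hamiltonian g := map_add ω.hamiltonianₗ f g

end InvariantSymplecticForm

theorem mul_mem_ord {f g : FormalFn n} {i j : ℕ} (hf : f ∈ ord (M := FormalFn n) i)
    (hg : g ∈ ord (M := FormalFn n) j) : f * g ∈ ord (M := FormalFn n) (i + j) := by
  intro k hk
  rw [PowerSeries.coeff_mul]
  refine Finset.sum_eq_zero fun p hp => ?_
  have hp := Finset.HasAntidiagonal.mem_antidiagonal.1 hp
  by_cases h : p.1 < i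
  · rw [hf _ h, zero_mul]
  · rw [hg _ (by omega), mul_zero]

theorem fpd_mem_ord {f : FormalFn n} {i : ℕ} (a : Fin (2 * n)) (hf : f ∈ ord (M := FormalFn n) i) :
    fpd a f ∈ ord (M := FormalFn n) i := fun k hk => by
  rw [coeff_fpd, hf k hk, ← pdₗ_apply, map_zero]

theorem act_mem_ord {X : FormalVF n} {f : FormalFn n} {i j : ℕ} (hX : X ∈ ord (M := FormalVF n) i)
    (hf : f ∈ ord (M := FormalFn n) j) : X.act f ∈ ord (M := FormalFn n) (i + j) :=
  Submodule.sum_mem _ fun a _ => mul_mem_ord (mem_ord_pi.1 hX a) (fpd_mem_ord a hf)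

theorem bracket_mem_ord {X Y : FormalVF n} {i j : ℕ} (hX : X ∈ ord (M := FormalVF n) i)
    (hY : Y ∈ ord (M := FormalVF n) j) : X.bracket Y ∈ ord (M := FormalVF n) (i + j) :=
  mem_ord_pi.2 fun c => Submodule.sub_mem _ (act_mem_ord hX (mem_ord_pi.1 hY c))
    (by rw [add_comm]; exact act_mem_ord hY (mem_ord_pi.1 hX c))

theorem app_mem_ord {X Y : FormalVF n} {i j : ℕ} (hX : X ∈ ord (M := FormalVF n) i)
    (hY : Y ∈ ord (M := FormalVF n) j) : ω.app X Y ∈ ord (M := FormalFn n) (i + j) :=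
  Submodule.sum_mem _ fun a _ => Submodule.sum_mem _ fun b _ => Submodule.smul_mem _ _
    (mul_mem_ord (mem_ord_pi.1 hX a) (mem_ord_pi.1 hY b))

theorem hamiltonian_mem_ord {f : FormalFn n} {i : ℕ} (hf : f ∈ ord (M := FormalFn n) i) :
    ω.hamiltonian f ∈ ord (M := FormalVF n) i :=
  mem_ord_pi.2 fun _ => Submodule.sum_mem _ fun b _ => Submodule.smul_mem _ _ (fpd_mem_ord b hf)

end VectorFields

/-! ### Formal connections and their filtration -/

open Filtered FormalVF

variable {n : ℕ}

namespace FormalConnection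

variable (D : FormalConnection n)

theorem cov_add_left (X Y Z : FormalVF n) : D.cov (X + Y) Z = D.cov X Z + D.cov Y Z := by
  funext c
  simp only [cov, Pi.add_apply, act_add_left, add_mul, Finset.sum_add_distrib]
  ring

theorem cov_add_right (X Y Z : FormalVF n) : D.cov X (Y + Z) = D.cov X Y + D.cov X Z := by
  funext c
  simp only [cov, Pi.add_apply, act_add_right, add_mul, mul_add, Finset.sum_add_distrib]
  ring

/-- The covariant derivative as a bilinear map. -/
def covₗ : FormalVF n →ₗ[ℝ] FormalVF n →ₗ[ℝ] FormalVF n :=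
  LinearMap.mk₂ ℝ D.cov D.cov_add_left
    (fun r X Y => by
      funext c
      simp only [cov, Pi.smul_apply, ← actₗ_apply, map_smul, LinearMap.smul_apply, smul_add,
        smul_mul_assoc, Finset.smul_sum])
    D.cov_add_right
    (fun r X Y => by
      funext c
      simp only [cov, Pi.smul_apply, ← actₗ_apply, map_smul, smul_add, smul_mul_assoc,
        mul_smul_comm, Finset.smul_sum])

theorem covₗ_apply (X Y : FormalVF n) : D.covₗ X Y = D.cov X Y := rfl

theorem cov_smul_left (f : FormalFn n) (X Y : FormalVF n) : D.cov (f • X) Y = f • D.cov X Y := by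
  funext c
  simp only [cov, Pi.smul_apply, smul_eq_mul, act_smul_left, mul_add, Finset.mul_sum, mul_assoc]

theorem cov_smul_right (f : FormalFn n) (X Y : FormalVF n) :
    D.cov X (f • Y) = X.act f • Y + f • D.cov X Y := by
  funext c
  simp only [cov, Pi.add_apply, Pi.smul_apply, smul_eq_mul, act_mul, mul_add, Finset.mul_sum,
    mul_assoc, mul_left_comm f, add_assoc]

theorem cov_frame (a b : Fin (2 * n)) : D.cov (frame a) (frame b) = D.coef a b := by
  funext c
  rw [cov, act_frame_apply]
  simp [frame, Pi.single_apply]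

/-- The covariant derivative is determined by its values on the frame and the Leibniz rule. -/
theorem cov_eq_of_leibniz (C : FormalVF n →ₗ[ℝ] FormalVF n →ₗ[ℝ] FormalVF n)
    (h1 : ∀ (f : FormalFn n) X Y, C (f • X) Y = f • C X Y)
    (h2 : ∀ (f : FormalFn n) X Y, C X (f • Y) = X.act f • Y + f • C X Y)
    (h3 : ∀ a b, D.coef a b = C (frame a) (frame b)) (X Y : FormalVF n) : D.cov X Y = C X Y := by
  have h4 : ∀ a b, D.cov (frame a) (frame b) = C (frame a) (frame b) := fun a b => by
    rw [cov_frame, h3]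
  have h5 : ∀ X b, D.cov X (frame b) = C X (frame b) := by
    intro X b
    rw [eq_sum_frame X, ← covₗ_apply, map_sum, map_sum, LinearMap.sum_apply, LinearMap.sum_apply]
    refine Finset.sum_congr rfl fun a _ => ?_
    rw [h1, covₗ_apply, cov_smul_left, h4]
  rw [eq_sum_frame Y, ← covₗ_apply, map_sum, map_sum]
  refine Finset.sum_congr rfl fun a _ => ?_
  rw [h2, covₗ_apply, cov_smul_right, h5]

variable {D}

theorem StartsAtStandard.coef_mem (hD : D.StartsAtStandard) (a b c : Fin (2 * n)) :
    D.coef a b c ∈ ord (M := FormalFn n) 1 := fun i hi => by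
  rw [Nat.lt_one_iff.1 hi]
  exact hD a b c

theorem cov_mem_ord {X Y : FormalVF n} {i j : ℕ} (hX : X ∈ ord (M := FormalVF n) i)
    (hY : Y ∈ ord (M := FormalVF n) j) : D.cov X Y ∈ ord (M := FormalVF n) (i + j) :=
  mem_ord_pi.2 fun c => Submodule.add_mem _ (act_mem_ord hX (mem_ord_pi.1 hY c))
    (Submodule.sum_mem _ fun a _ => Submodule.sum_mem _ fun b _ => mul_mem_ord (j := 0)
      (mul_mem_ord (mem_ord_pi.1 hX a) (mem_ord_pi.1 hY b)) (ord_zero _))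

theorem StartsAtStandard.cov_sub_act_mem (hD : D.StartsAtStandard) {X Y : FormalVF n} {i j : ℕ}
    (hX : X ∈ ord (M := FormalVF n) i) (hY : Y ∈ ord (M := FormalVF n) j) :
    (D.cov X Y - fun c => X.act (Y c)) ∈ ord (M := FormalVF n) (i + j + 1) :=
  mem_ord_pi.2 fun c => by
    simp only [cov, Pi.sub_apply, add_sub_cancel_left]
    exact Submodule.sum_mem _ fun a _ => Submodule.sum_mem _ fun b _ => mul_mem_ord
      (mul_mem_ord (mem_ord_pi.1 hX a) (mem_ord_pi.1 hY b)) (hD.coef_mem a b c)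

end FormalConnection

/-! ### Formal Hamiltonian flows acting on functions, fields and connections -/

variable (ω : InvariantSymplecticForm n)

theorem raises_act {h : FormalFn n} {k : ℕ} (hh : h ∈ ord (M := FormalFn n) k) :
    Raises k (actₗ (ω.hamiltonian h)) := fun m x hx => by
  rw [add_comm]
  exact act_mem_ord (hamiltonian_mem_ord ω hh) hx

theorem raises_bracket {h : FormalFn n} {k : ℕ} (hh : h ∈ ord (M := FormalFn n) k) :
    Raises k (bracketₗ (ω.hamiltonian h)) := fun m x hx => by
  rw [add_comm]
  exact bracket_mem_ord (hamiltonian_mem_ord ω hh) hx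

/-- The action on functions of the formal flow of a Hamiltonian without constant term. -/
def gaugeFn (h : FormalFn n) (hh : h ∈ ord (M := FormalFn n) 1) : FormalFn n →ₗ[ℝ] FormalFn n :=
  fexp _ (raises_act ω hh)

/-- The action on vector fields of the formal flow of a Hamiltonian without constant term. -/
def gaugeVF (h : FormalFn n) (hh : h ∈ ord (M := FormalFn n) 1) : FormalVF n →ₗ[ℝ] FormalVF n :=
  fexp _ (raises_bracket ω hh)

section

variable (h : FormalFn n) (hh : h ∈ ord (M := FormalFn n) 1)

theorem gaugeFn_mul (f g : FormalFn n) :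
    gaugeFn ω h hh (f * g) = gaugeFn ω h hh f * gaugeFn ω h hh g := by
  have key := fexp_bilinear (B := LinearMap.mul ℝ (FormalFn n))
    (fun _ _ _ hx _ hy => mul_mem_ord hx hy) (raises_act ω hh) (raises_act ω hh) (raises_act ω hh)
    (fun f g => act_mul _ f g) f g
  rw [LinearMap.mul_apply', LinearMap.mul_apply'] at key
  exact key

theorem gaugeVF_smul (f : FormalFn n) (X : FormalVF n) :
    gaugeVF ω h hh (f • X) = gaugeFn ω h hh f • gaugeVF ω h hh X := by
  let B : FormalFn n →ₗ[ℝ] FormalVF n →ₗ[ℝ] FormalVF n :=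
    LinearMap.mk₂ ℝ (fun f X => f • X) (fun f g X => add_smul f g X)
      (fun r f X => smul_assoc r f X) (fun f X Y => smul_add f X Y)
      (fun r f X => smul_comm f r X)
  have hB : ∀ f X, B f X = f • X := fun f X => rfl
  have key := fexp_bilinear (B := B) (fun i j x hx y hy => by
      rw [hB]
      exact mem_ord_pi.2 fun c => mul_mem_ord hx (mem_ord_pi.1 hy c))
    (raises_act ω hh) (raises_bracket ω hh) (raises_bracket ω hh)
    (fun f X => by
      rw [hB, hB, hB]
      exact bracket_smul_right _ f X) f X
  rw [hB, hB] at key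
  exact key

theorem gauge_act (X : FormalVF n) (f : FormalFn n) :
    gaugeFn ω h hh (X.act f) = (gaugeVF ω h hh X).act (gaugeFn ω h hh f) := by
  have key := fexp_bilinear (B := actₗ (n := n)) (fun _ _ _ hx _ hy => act_mem_ord hx hy)
    (raises_bracket ω hh) (raises_act ω hh) (raises_act ω hh)
    (fun X f => by simp only [actₗ_apply, bracketₗ_apply, act_bracket, sub_add_cancel]) X f
  rw [actₗ_apply, actₗ_apply] at key
  exact key

theorem gauge_app (X Y : FormalVF n) :
    gaugeFn ω h hh (ω.app X Y) = ω.app (gaugeVF ω h hh X) (gaugeVF ω h hh Y) := by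
  have key := fexp_bilinear (B := ω.appₗ) (fun _ _ _ hx _ hy => app_mem_ord ω hx hy)
    (raises_bracket ω hh) (raises_bracket ω hh) (raises_act ω hh)
    (fun X Y => ω.hamiltonian_act_app h X Y) X Y
  rw [ω.appₗ_apply, ω.appₗ_apply] at key
  exact key

theorem gaugeVF_bracket (X Y : FormalVF n) :
    gaugeVF ω h hh (X.bracket Y) = (gaugeVF ω h hh X).bracket (gaugeVF ω h hh Y) := by
  have key := fexp_bilinear (B := bracketₗ (n := n)) (fun _ _ _ hx _ hy => bracket_mem_ord hx hy)
    (raises_bracket ω hh) (raises_bracket ω hh) (raises_bracket ω hh)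
    (fun X Y => bracket_bracket _ X Y) X Y
  rw [bracketₗ_apply, bracketₗ_apply] at key
  exact key

theorem gaugeFn_fpoisson (f g : FormalFn n) :
    gaugeFn ω h hh (ω.fpoisson f g) = ω.fpoisson (gaugeFn ω h hh f) (gaugeFn ω h hh g) := by
  have hB : ∀ f g, (actₗ ∘ₗ ω.hamiltonianₗ) f g = ω.fpoisson f g := fun f g => rfl
  have key := fexp_bilinear (B := actₗ ∘ₗ ω.hamiltonianₗ)
    (fun _ _ _ hx _ hy => act_mem_ord (hamiltonian_mem_ord ω hx) hy)
    (raises_act ω hh) (raises_act ω hh) (raises_act ω hh)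
    (fun f g => by
      change (ω.hamiltonian h).act ((ω.hamiltonian f).act g)
        = (ω.hamiltonian (ω.fpoisson h f)).act g + (ω.hamiltonian f).act ((ω.hamiltonian h).act g)
      rw [ω.hamiltonian_fpoisson, act_bracket, sub_add_cancel]) f g
  rw [hB, hB] at key
  exact key

/-- `gaugeVF` as an equivalence. -/
def gaugeEquiv : FormalVF n ≃ₗ[ℝ] FormalVF n :=
  LinearEquiv.ofBijective (gaugeVF ω h hh) (fexp_bijective (raises_bracket ω hh))

theorem gaugeEquiv_apply (X : FormalVF n) : gaugeEquiv ω h hh X = gaugeVF ω h hh X := rfl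

/-- `gaugeFn` as an equivalence. -/
def gaugeFnEquiv : FormalFn n ≃ₗ[ℝ] FormalFn n :=
  LinearEquiv.ofBijective (gaugeFn ω h hh) (fexp_bijective (raises_act ω hh))

theorem gaugeFnEquiv_apply (f : FormalFn n) : gaugeFnEquiv ω h hh f = gaugeFn ω h hh f := rfl

theorem gaugeEquiv_symm_smul (f : FormalFn n) (X : FormalVF n) :
    (gaugeEquiv ω h hh).symm (f • X)
      = (gaugeFnEquiv ω h hh).symm f • (gaugeEquiv ω h hh).symm X := by
  rw [LinearEquiv.symm_apply_eq, gaugeEquiv_apply, gaugeVF_smul, ← gaugeFnEquiv_apply,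
    ← gaugeEquiv_apply, LinearEquiv.apply_symm_apply, LinearEquiv.apply_symm_apply]

variable (D : FormalConnection n)

/-- The transform of a connection by a formal Hamiltonian flow, as a bilinear map. -/
def gaugeCov : FormalVF n →ₗ[ℝ] FormalVF n →ₗ[ℝ] FormalVF n :=
  (D.covₗ.compl₁₂ (gaugeEquiv ω h hh).symm.toLinearMap (gaugeEquiv ω h hh).symm.toLinearMap).compr₂
    (gaugeVF ω h hh)

theorem gaugeCov_apply (X Y : FormalVF n) : gaugeCov ω h hh D X Y
    = gaugeVF ω h hh (D.cov ((gaugeEquiv ω h hh).symm X) ((gaugeEquiv ω h hh).symm Y)) := rfl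

/-- The transform of a connection by a formal Hamiltonian flow. -/
def gaugeConn : FormalConnection n := ⟨fun a b => gaugeCov ω h hh D (frame a) (frame b)⟩

/-- The conjugated operator is linear over functions in the first argument and obeys the Leibniz
rule in the second, so its values on the frame determine it. -/
theorem gaugeConn_cov (X Y : FormalVF n) :
    (gaugeConn ω h hh D).cov (gaugeVF ω h hh X) (gaugeVF ω h hh Y)
      = gaugeVF ω h hh (D.cov X Y) := by
  rw [(gaugeConn ω h hh D).cov_eq_of_leibniz (gaugeCov ω h hh D) _ _ fun a b => rfl]
  · have hs : ∀ X, (gaugeEquiv ω h hh).symm (gaugeVF ω h hh X) = X := fun X =>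
      (gaugeEquiv ω h hh).symm_apply_apply X
    rw [gaugeCov_apply, hs, hs]
  · intro f X Y
    rw [gaugeCov_apply, gaugeEquiv_symm_smul, D.cov_smul_left, gaugeVF_smul, ← gaugeFnEquiv_apply,
      LinearEquiv.apply_symm_apply, gaugeCov_apply]
  · intro f X Y
    rw [gaugeCov_apply, gaugeEquiv_symm_smul, D.cov_smul_right, map_add, gaugeVF_smul,
      gaugeVF_smul, gauge_act, ← gaugeFnEquiv_apply, ← gaugeEquiv_apply, ← gaugeEquiv_apply,
      LinearEquiv.apply_symm_apply, LinearEquiv.apply_symm_apply, LinearEquiv.apply_symm_apply,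
      gaugeCov_apply]

theorem gaugeEquiv_symm_sub_mem (X : FormalVF n) :
    (gaugeEquiv ω h hh).symm X - X ∈ ord (M := FormalVF n) 1 := by
  obtain ⟨Y, rfl⟩ := (gaugeEquiv ω h hh).surjective X
  rw [LinearEquiv.symm_apply_apply, ← neg_sub]
  exact Submodule.neg_mem _ (fexp_sub_mem (raises_bracket ω hh) 0 Y (ord_zero Y))

variable {D}

theorem cov_symm_frame_mem (hD : D.StartsAtStandard) (a b : Fin (2 * n)) :
    D.cov ((gaugeEquiv ω h hh).symm (frame a)) ((gaugeEquiv ω h hh).symm (frame b))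
      ∈ ord (M := FormalVF n) 1 := by
  have ha := gaugeEquiv_symm_sub_mem ω h hh (frame a)
  have hb := gaugeEquiv_symm_sub_mem ω h hh (frame b)
  set X := (gaugeEquiv ω h hh).symm (frame a)
  set Y := (gaugeEquiv ω h hh).symm (frame b)
  have h1 : D.cov X Y = D.cov (X - frame a) Y + D.cov (frame a) (Y - frame b) + D.coef a b := by
    rw [← D.cov_frame]
    simp only [← D.covₗ_apply, map_sub, LinearMap.sub_apply]
    abel
  rw [h1]
  refine Submodule.add_mem _ (Submodule.add_mem _ ?_ ?_) (mem_ord_pi.2 (hD.coef_mem a b))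
  · exact FormalConnection.cov_mem_ord (j := 0) ha (ord_zero _)
  · have := FormalConnection.cov_mem_ord (D := D) (i := 0) (ord_zero (frame a)) hb
    rwa [zero_add] at this

theorem gaugeConn_startsAtStandard (hD : D.StartsAtStandard) :
    (gaugeConn ω h hh D).StartsAtStandard := fun a b c =>
  mem_ord_pi.1 (fexp_mem (raises_bracket ω hh) 1 _ (cov_symm_frame_mem ω h hh hD a b)) c 0 one_pos

theorem gaugeVF_add_sub_mem {g : FormalFn n} {k : ℕ} (hk : 1 ≤ k)
    (hg : g ∈ ord (M := FormalFn n) k) (hhg : h + g ∈ ord (M := FormalFn n) 1) (Z : FormalVF n) :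
    gaugeVF ω (h + g) hhg Z - gaugeVF ω h hh Z - (ω.hamiltonian g).bracket Z
      ∈ ord (M := FormalVF n) (k + 1) := by
  have hsum : bracketₗ (ω.hamiltonian (h + g))
      = bracketₗ (ω.hamiltonian h) + bracketₗ (ω.hamiltonian g) := by
    rw [ω.hamiltonian_add, map_add]
  have h1 := fexp_sub_sub_mem (raises_bracket ω hh) (raises_bracket ω hhg) hsum hk
    (raises_bracket ω hg) Z
  rw [bracketₗ_apply] at h1
  exact h1

/-- The first-order effect on a connection of a change of the Hamiltonian. -/
theorem gaugeConn_add_sub_mem (hD : D.StartsAtStandard) {g : FormalFn n} {k : ℕ} (hk : 1 ≤ k)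
    (hg : g ∈ ord (M := FormalFn n) k) (hhg : h + g ∈ ord (M := FormalFn n) 1)
    (a b c : Fin (2 * n)) :
    (gaugeConn ω (h + g) hhg D).coef a b c - (gaugeConn ω h hh D).coef a b c
      - fpd a (fpd b (ω.hamiltonian g c)) ∈ ord (M := FormalFn n) (k + 1) := by
  set X := (gaugeEquiv ω h hh).symm (frame a) with hX
  set Y := (gaugeEquiv ω h hh).symm (frame b) with hY
  set G := ω.hamiltonian g with hG
  have hGk : G ∈ ord (M := FormalVF n) k := hamiltonian_mem_ord ω hg
  have hΨ := gaugeVF_add_sub_mem ω h hh hk hg hhg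
  -- The new flow takes the old preimage of `∂_a` to `∂_a + [G, ∂_a]` up to order `k + 1`, and `[G,
  -- ∂_a] = -∂_a G`.
  have hp : ∀ a, gaugeVF ω (h + g) hhg ((gaugeEquiv ω h hh).symm (frame a)) - frame a
      + (fun c => fpd a (G c)) ∈ ord (M := FormalVF n) (k + 1) := by
    intro a
    have h1 := hΨ ((gaugeEquiv ω h hh).symm (frame a))
    have h2 := bracket_mem_ord hGk (gaugeEquiv_symm_sub_mem ω h hh (frame a))
    have h3 : G.bracket (frame a) = -fun c => fpd a (G c) := by
      funext c
      simp [bracket, act_frame_apply, act_frame]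
    rw [← gaugeEquiv_apply ω h hh, LinearEquiv.apply_symm_apply] at h1
    rw [← bracketₗ_apply, map_sub, bracketₗ_apply, bracketₗ_apply, h3] at h2
    convert Submodule.add_mem _ h1 h2 using 1
    abel
  have hq : ∀ a, (fun c => fpd a (G c)) ∈ ord (M := FormalVF n) k := fun a =>
    mem_ord_pi.2 fun c => fpd_mem_ord a (mem_ord_pi.1 hGk c)
  have hp' : ∀ a, gaugeVF ω (h + g) hhg ((gaugeEquiv ω h hh).symm (frame a)) - frame a
      ∈ ord (M := FormalVF n) k := by
    intro a
    have := Submodule.sub_mem _ (anti (Nat.le_succ k) (hp a)) (hq a)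
    rwa [add_sub_cancel_right] at this
  have hZ := cov_symm_frame_mem ω h hh hD a b
  have e1 := hΨ (D.cov X Y)
  -- `D.cov X Y` has order at least one, so at order `k` both flows transport it alike; the change
  -- of coefficients comes only from the displaced frames.
  have e2 : G.bracket (D.cov X Y) ∈ ord (M := FormalVF n) (k + 1) := bracket_mem_ord hGk hZ
  have hstd := gaugeConn_startsAtStandard ω (h + g) hhg hD
  set D' := gaugeConn ω (h + g) hhg D with hD'
  have e3 : D'.cov (gaugeVF ω (h + g) hhg X) (gaugeVF ω (h + g) hhg Y)
      = gaugeVF ω (h + g) hhg (D.cov X Y) := gaugeConn_cov ω (h + g) hhg D X Y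
  have hpa := hp' a
  have hpb := hp' b
  have hpb' := hp b
  rw [← hX] at hpa
  rw [← hY] at hpb hpb'
  set p := gaugeVF ω (h + g) hhg X - frame a
  set q := gaugeVF ω (h + g) hhg Y - frame b
  have e4 : D'.cov (gaugeVF ω (h + g) hhg X) (gaugeVF ω (h + g) hhg Y)
      = D'.coef a b + D'.cov p (frame b) + D'.cov (frame a) q + D'.cov p q := by
    rw [← D'.cov_frame]
    simp only [p, q, ← D'.covₗ_apply, map_sub, LinearMap.sub_apply]
    abel
  have e5 : D'.cov p (frame b) ∈ ord (M := FormalVF n) (k + 1) := by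
    have := hstd.cov_sub_act_mem hpa (ord_zero (frame b))
    have h0 : (fun c => p.act ((frame b : FormalVF n) c)) = 0 :=
      funext fun c => act_frame_apply p b c
    rwa [h0, sub_zero] at this
  have e6 : D'.cov p q ∈ ord (M := FormalVF n) (k + 1) :=
    anti (by omega) (FormalConnection.cov_mem_ord hpa hpb)
  -- Of the frame corrections only this one survives: differentiating `q ≡ -∂_b G` along `∂_a` with
  -- the flat connection gives `-∂_a ∂_b G`.
  have e7 : D'.cov (frame a) q + (fun c => fpd a (fpd b (G c))) ∈ ord (M := FormalVF n) (k + 1) := by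
    have h1 := hstd.cov_sub_act_mem (ord_zero (frame a)) hpb
    have h2 : (fun c => fpd a ((q + fun c => fpd b (G c)) c)) ∈ ord (M := FormalVF n) (k + 1) :=
      mem_ord_pi.2 fun c => fpd_mem_ord a (mem_ord_pi.1 hpb' c)
    rw [zero_add] at h1
    convert Submodule.add_mem _ h1 h2 using 1
    funext c
    simp only [Pi.add_apply, Pi.sub_apply, act_frame, fpd_add]
    ring
  have e8 : (gaugeConn ω h hh D).coef a b = gaugeVF ω h hh (D.cov X Y) := rfl
  rw [e3] at e4
  have e9 : D'.coef a b - (gaugeConn ω h hh D).coef a b - (fun c => fpd a (fpd b (G c)))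
      ∈ ord (M := FormalVF n) (k + 1) := by
    have := Submodule.sub_mem _ (Submodule.sub_mem _ (Submodule.sub_mem _
      (Submodule.add_mem _ e1 e2) e5) e6) e7
    convert this using 1
    rw [e8, e4]
    abel
  exact mem_ord_pi.1 e9 c

end

/-! ### Curvature in the frame and Ricci shape -/

namespace FormalConnection

variable (D : FormalConnection n)

theorem curv_swap (X Y Z : FormalVF n) : D.curv X Y Z = -D.curv Y X Z := by
  have h : D.cov (X.bracket Y) Z = -D.cov (Y.bracket X) Z := by
    rw [bracket_swap, ← covₗ_apply, map_neg, LinearMap.neg_apply, covₗ_apply]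
  rw [curv, curv, h]
  abel

theorem curv_add_left (X X' Y Z : FormalVF n) :
    D.curv (X + X') Y Z = D.curv X Y Z + D.curv X' Y Z := by
  simp only [curv, cov_add_left, cov_add_right, bracket_add_left]
  abel

theorem curv_add_right (X Y Z Z' : FormalVF n) :
    D.curv X Y (Z + Z') = D.curv X Y Z + D.curv X Y Z' := by
  simp only [curv, cov_add_right]
  abel

theorem curv_smul_left (f : FormalFn n) (X Y Z : FormalVF n) :
    D.curv (f • X) Y Z = f • D.curv X Y Z := by
  have h : (f • X).bracket Y = f • X.bracket Y + (-Y.act f) • X := by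
    rw [bracket_swap, bracket_smul_right, bracket_swap Y X]
    funext c
    simp only [Pi.add_apply, Pi.neg_apply, Pi.smul_apply, smul_eq_mul]
    ring
  rw [curv, h, cov_smul_left, cov_smul_left, cov_add_left, cov_smul_left, cov_smul_left,
    cov_smul_right, curv]
  funext c
  simp only [Pi.add_apply, Pi.sub_apply, Pi.smul_apply, smul_eq_mul]
  ring

theorem curv_smul_right (f : FormalFn n) (X Y Z : FormalVF n) :
    D.curv X Y (f • Z) = f • D.curv X Y Z := by
  simp only [curv, cov_smul_right, cov_add_right, act_bracket]
  funext c
  simp only [Pi.add_apply, Pi.sub_apply, Pi.smul_apply, smul_eq_mul]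
  ring

theorem isFlat_of_frame (h : ∀ a b c, D.curv (frame a) (frame b) (frame c) = 0) : D.IsFlat := by
  have hsum : ∀ (F : FormalVF n → FormalVF n), (∀ X Y, F (X + Y) = F X + F Y) →
      (∀ (f : FormalFn n) X, F (f • X) = f • F X) → (∀ a, F (frame a) = 0) → ∀ X, F X = 0 := by
    intro F h1 h2 h3 X
    have h0 : F 0 = 0 := by simpa using h2 0 0
    have h4 : ∀ s : Finset (Fin (2 * n)), F (∑ a ∈ s, X a • frame a) = 0 := by
      intro s
      induction s using Finset.induction_on with
      | empty => simpa using h0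
      | insert a s ha ih => rw [Finset.sum_insert ha, h1, ih, h2, h3, smul_zero, add_zero]
    rw [eq_sum_frame X]
    exact h4 _
  have h1 : ∀ a b Z, D.curv (frame a) (frame b) Z = 0 := fun a b =>
    hsum _ (D.curv_add_right _ _) (fun f => D.curv_smul_right f _ _) (h a b)
  have h2 : ∀ X b Z, D.curv X (frame b) Z = 0 := fun X b Z =>
    hsum (fun X => D.curv X (frame b) Z) (fun X Y => D.curv_add_left _ _ _ _)
      (fun f X => D.curv_smul_left f _ _ _) (fun a => h1 a b Z) X
  intro X Y Z
  rw [curv_swap, neg_eq_zero]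
  exact hsum (fun Y => D.curv Y X Z) (fun X Y => D.curv_add_left _ _ _ _)
      (fun f X => D.curv_smul_left f _ _ _)
      (fun a => by rw [curv_swap, h2, neg_zero]) Y

theorem curv_frame (a b c d : Fin (2 * n)) : D.curv (frame a) (frame b) (frame c) d
    = fpd a (D.coef b c d) - fpd b (D.coef a c d)
      + ∑ e, (D.coef b c e * D.coef a e d - D.coef a c e * D.coef b e d) := by
  have h1 : ∀ (a : Fin (2 * n)) (Y : FormalVF n), D.cov (frame a) Y d
      = fpd a (Y d) + ∑ e, Y e * D.coef a e d := by
    intro a Y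
    rw [cov, act_frame]
    simp [frame, Pi.single_apply]
  have h2 : D.cov (bracket (frame a) (frame b)) (frame c) = 0 := by
    rw [bracket_frame, ← covₗ_apply, map_zero, LinearMap.zero_apply]
  rw [curv, h2, sub_zero, Pi.sub_apply, cov_frame, cov_frame, h1, h1, Finset.sum_sub_distrib]
  ring

theorem IsFlat.isRicciType {D : FormalConnection n} (h : D.IsFlat)
    (ω : InvariantSymplecticForm n) : D.IsRicciType ω := by
  intro X Y Z T
  have h1 : ∀ X Y, D.ricci X Y = 0 := fun X Y => by simp [ricci, h X _ Y]
  have h2 : ω.app 0 T = 0 := by rw [← ω.appₗ_apply, map_zero, LinearMap.zero_apply]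
  simp [weylPart, ricciPart, h1, h X Y Z, h2]

section Symplectic

variable {D} {ω : InvariantSymplecticForm n}

theorem IsSymplectic.coef_symm (hD : D.IsSymplectic ω) (a b : Fin (2 * n)) :
    D.coef a b = D.coef b a := by
  have := hD.torsion_free (frame a) (frame b)
  rwa [bracket_frame, cov_frame, cov_frame, sub_eq_zero] at this

theorem IsSymplectic.app_coef_symm (hD : D.IsSymplectic ω) (a b c : Fin (2 * n)) :
    ω.app (D.coef a b) (frame c) = ω.app (D.coef a c) (frame b) := by
  have h := hD.parallel (frame a) (frame b) (frame c)
  rw [cov_frame, cov_frame, ω.app_swap (frame b) (D.coef a c), ω.act_app] at h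
  have h0 : ∀ b, (fun c => (frame a).act ((frame b : FormalVF n) c)) = 0 := fun b =>
    funext fun c => act_frame_apply _ _ _
  rw [h0, h0, ← ω.appₗ_apply, ← ω.appₗ_apply, map_zero, map_zero, LinearMap.zero_apply] at h
  linear_combination -h

end Symplectic

/-- The curvature of the connection is of Ricci type for some bilinear form `s`. -/
def HasRicciShape (ω : InvariantSymplecticForm n) (s : FormalVF n → FormalVF n → FormalFn n) :
    Prop :=
  ∀ X Y Z T, ω.app (D.curv X Y Z) T = 2 * ω.app X Y * s Z T + ω.app X Z * s Y T
    + ω.app X T * s Y Z - ω.app Y Z * s X T - ω.app Y T * s X Z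

variable {D} {ω : InvariantSymplecticForm n}

/-- The Ricci tensor is replaced by an unspecified `s`, so that the condition can be transported by
a flow without following the trace that defines it. -/
theorem IsRicciType.hasRicciShape (hD : D.IsRicciType ω) : ∃ s, D.HasRicciShape ω s := by
  refine ⟨fun X Y => (-1 / (2 * ((n : ℝ) + 1))) • D.ricci X Y, fun X Y Z T => ?_⟩
  have h := hD X Y Z T
  rw [weylPart, sub_eq_zero] at h
  rw [h, ricciPart]
  simp only [mul_smul_comm, smul_add, smul_sub]

theorem app_frame_frame (a b : Fin (2 * n)) :
    ω.app (frame a) (frame b) = ω.mat a b • (1 : FormalFn n) := by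
  rw [ω.app_frame_right]
  simp [frame, Pi.single_apply]

theorem HasRicciShape.frame {s : FormalVF n → FormalVF n → FormalFn n}
    (hD : D.HasRicciShape ω s) (a b c d : Fin (2 * n)) :
    ω.app (D.curv (frame a) (frame b) (frame c)) (FormalVF.frame d)
      = ω.ricciForm (fun c d => s (FormalVF.frame c) (FormalVF.frame d)) a b c d := by
  rw [hD, InvariantSymplecticForm.ricciForm]
  simp only [app_frame_frame, smul_mul_assoc, one_mul, mul_smul_comm, mul_one]
  rw [two_mul, two_smul, smul_add]

end FormalConnection

/-! ### Naturality of the conditions on the connection -/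

section Gauge

variable {ω : InvariantSymplecticForm n} {D : FormalConnection n} (h : FormalFn n)
  (hh : h ∈ ord (M := FormalFn n) 1)

theorem gaugeVF_surjective (X : FormalVF n) : ∃ Y, gaugeVF ω h hh Y = X :=
  (gaugeEquiv ω h hh).surjective X

theorem gaugeConn_isSymplectic (hD : D.IsSymplectic ω) : (gaugeConn ω h hh D).IsSymplectic ω where
  torsion_free X Y := by
    obtain ⟨X, rfl⟩ := gaugeVF_surjective (ω := ω) h hh X
    obtain ⟨Y, rfl⟩ := gaugeVF_surjective (ω := ω) h hh Y
    rw [gaugeConn_cov, gaugeConn_cov, ← map_sub, hD.torsion_free, gaugeVF_bracket]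
  parallel X Y Z := by
    obtain ⟨X, rfl⟩ := gaugeVF_surjective (ω := ω) h hh X
    obtain ⟨Y, rfl⟩ := gaugeVF_surjective (ω := ω) h hh Y
    obtain ⟨Z, rfl⟩ := gaugeVF_surjective (ω := ω) h hh Z
    rw [gaugeConn_cov, gaugeConn_cov, ← gauge_app, ← gauge_act, hD.parallel, map_add, gauge_app,
      gauge_app]

theorem gaugeConn_curv (X Y Z : FormalVF n) :
    (gaugeConn ω h hh D).curv (gaugeVF ω h hh X) (gaugeVF ω h hh Y) (gaugeVF ω h hh Z)
      = gaugeVF ω h hh (D.curv X Y Z) := by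
  simp only [FormalConnection.curv, gaugeConn_cov, ← gaugeVF_bracket, map_sub]

theorem gaugeConn_hasRicciShape {s : FormalVF n → FormalVF n → FormalFn n}
    (hD : D.HasRicciShape ω s) : ∃ s', (gaugeConn ω h hh D).HasRicciShape ω s' := by
  refine ⟨fun X Y => gaugeFn ω h hh (s ((gaugeEquiv ω h hh).symm X) ((gaugeEquiv ω h hh).symm Y)),
    fun X Y Z T => ?_⟩
  obtain ⟨X, rfl⟩ := gaugeVF_surjective (ω := ω) h hh X
  obtain ⟨Y, rfl⟩ := gaugeVF_surjective (ω := ω) h hh Y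
  obtain ⟨Z, rfl⟩ := gaugeVF_surjective (ω := ω) h hh Z
  obtain ⟨T, rfl⟩ := gaugeVF_surjective (ω := ω) h hh T
  have hs : ∀ X, (gaugeEquiv ω h hh).symm (gaugeVF ω h hh X) = X := fun X =>
    (gaugeEquiv ω h hh).symm_apply_apply X
  rw [gaugeConn_curv, ← gauge_app, hD]
  simp only [hs, two_mul, add_mul, map_add, map_sub, gaugeFn_mul, gauge_app]

theorem isFlat_of_gaugeConn (hD : (gaugeConn ω h hh D).IsFlat) : D.IsFlat := fun X Y Z => by
  have := hD (gaugeVF ω h hh X) (gaugeVF ω h hh Y) (gaugeVF ω h hh Z)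
  rw [gaugeConn_curv] at this
  exact (gaugeEquiv ω h hh).map_eq_zero_iff.1 this

end Gauge

/-! ### Order-by-order reduction to constant coefficients -/

section OrderByOrder

variable {ω : InvariantSymplecticForm n}

/-- `⊥` is the algebra of constant functions. With no terms of order zero, the order-`k` coefficient
of the product involves only orders below `k`; this makes the quadratic part of the curvature
constant. -/
theorem coeff_mul_mem_bot {x y : FormalFn n} {k : ℕ} (hx : x ∈ ord (M := FormalFn n) 1)
    (hy : y ∈ ord (M := FormalFn n) 1)
    (hxc : ∀ i < k, PowerSeries.coeff i x ∈ (⊥ : Subalgebra ℝ (Fn n)))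
    (hyc : ∀ i < k, PowerSeries.coeff i y ∈ (⊥ : Subalgebra ℝ (Fn n))) :
    PowerSeries.coeff k (x * y) ∈ (⊥ : Subalgebra ℝ (Fn n)) := by
  rw [PowerSeries.coeff_mul]
  refine Subalgebra.sum_mem _ fun p hp => ?_
  have hp := Finset.HasAntidiagonal.mem_antidiagonal.1 hp
  by_cases h1 : p.1 = 0
  · rw [h1, hx 0 one_pos, zero_mul]
    exact Subalgebra.zero_mem _
  · by_cases h2 : p.2 = 0
    · rw [h2, hy 0 one_pos, mul_zero]
      exact Subalgebra.zero_mem _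
    · exact Subalgebra.mul_mem _ (hxc _ (by omega)) (hyc _ (by omega))

theorem coeff_app_frame (X : FormalVF n) (d : Fin (2 * n)) (k : ℕ) :
    PowerSeries.coeff k (ω.app X (frame d)) = ∑ a, ω.mat a d • PowerSeries.coeff k (X a) := by
  rw [ω.app_frame_right, map_sum]
  simp only [PowerSeries.coeff_smul]

/-- If a formal curve of Ricci type connections is invariant below order `k`, its term of order
`k` is the sum of an invariant tensor and a third derivative. -/
theorem exists_third_derivative_of_order (hn : 2 ≤ n) {D : FormalConnection n}
    (hstd : D.StartsAtStandard) (hsymp : D.IsSymplectic ω)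
    {s : FormalVF n → FormalVF n → FormalFn n} (hs : D.HasRicciShape ω s) {k : ℕ}
    (hc : ∀ i < k, ∀ a b c, PowerSeries.coeff i (D.coef a b c) ∈ (⊥ : Subalgebra ℝ (Fn n))) :
    ∃ f : Fn n, ∀ a b c, PowerSeries.coeff k (ω.app (D.coef a b) (frame c))
      - pd a (pd b (pd c f)) ∈ (⊥ : Subalgebra ℝ (Fn n)) := by
  set q : Fin (2 * n) → Fin (2 * n) → Fin (2 * n) → Fin (2 * n) → FormalFn n := fun a b c f =>
    ∑ e, (D.coef b c e * D.coef a e f - D.coef a c e * D.coef b e f) with hq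
  have hqc : ∀ a b c d, ∃ r : ℝ, algebraMap ℝ (Fn n) r
      = PowerSeries.coeff k (∑ f, ω.mat f d • q a b c f) := by
    intro a b c d
    refine Algebra.mem_bot.1 ?_
    rw [map_sum]
    refine Subalgebra.sum_mem _ fun f _ => ?_
    rw [PowerSeries.coeff_smul, hq, map_sum]
    refine Subalgebra.smul_mem _ (Subalgebra.sum_mem _ fun e _ => ?_) _
    rw [map_sub]
    have h := fun a b c => hstd.coef_mem a b c
    have h' := fun a b c i (hi : i < k) => hc i hi a b c
    exact Subalgebra.sub_mem _ (coeff_mul_mem_bot (h _ _ _) (h _ _ _) (h' _ _ _) (h' _ _ _))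
      (coeff_mul_mem_bot (h _ _ _) (h _ _ _) (h' _ _ _) (h' _ _ _))
  choose Q hQ using hqc
  obtain ⟨f, r, hf⟩ := exists_third_derivative_of_linear ω hn
    (fun a b c => PowerSeries.coeff k (ω.app (D.coef a b) (frame c)))
    (fun a b c => by rw [hsymp.coef_symm]) (fun a b c => by rw [hsymp.app_coef_symm])
    (fun c d => PowerSeries.coeff k (s (frame c) (frame d))) Q (by
      intro a b c d
      have h1 := congrArg (PowerSeries.coeff k) (hs.frame a b c d)
      have h2 : ω.app (D.curv (frame a) (frame b) (frame c)) (frame d)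
          = fpd a (ω.app (D.coef b c) (frame d)) - fpd b (ω.app (D.coef a c) (frame d))
            + ∑ f, ω.mat f d • q a b c f := by
        simp only [ω.app_frame_right, D.curv_frame, fpd_sum, fpd_smul, smul_add, smul_sub,
          Finset.sum_add_distrib, Finset.sum_sub_distrib, hq]
      rw [h2, map_add, map_sub, coeff_fpd, coeff_fpd, ← hQ] at h1
      rw [h1]
      simp only [InvariantSymplecticForm.ricciForm, map_add, map_sub, PowerSeries.coeff_smul])
  exact ⟨f, fun a b c => by rw [hf, add_sub_cancel_left]; exact Subalgebra.algebraMap_mem _ _⟩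

theorem gaugeConn_sub_mem {D : FormalConnection n} (hD : D.StartsAtStandard) {h h' : FormalFn n}
    (hh : h ∈ ord (M := FormalFn n) 1) (hh' : h' ∈ ord (M := FormalFn n) 1) {k : ℕ} (hk : 1 ≤ k)
    (hg : h' - h ∈ ord (M := FormalFn n) k) (a b c : Fin (2 * n)) :
    (gaugeConn ω h' hh' D).coef a b c - (gaugeConn ω h hh D).coef a b c
      - fpd a (fpd b (ω.hamiltonian (h' - h) c)) ∈ ord (M := FormalFn n) (k + 1) := by
  obtain ⟨g, rfl⟩ : ∃ g, h' = h + g := ⟨h' - h, by abel⟩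
  rw [add_sub_cancel_left] at hg ⊢
  exact gaugeConn_add_sub_mem ω h hh hD hk hg hh' a b c

/-- The Hamiltonian `h` makes the connection invariant below order `k`. -/
def InvariantBelow (ω : InvariantSymplecticForm n) (D : FormalConnection n) (k : ℕ)
    (h : FormalFn n) : Prop :=
  ∃ hh : h ∈ ord (M := FormalFn n) 1, ∀ i < k, ∀ a b c,
    PowerSeries.coeff i ((gaugeConn ω h hh D).coef a b c) ∈ (⊥ : Subalgebra ℝ (Fn n))

/-- A change of the Hamiltonian in order `k` leaves lower coefficients untouched. This preserves
earlier steps, and also carries the property to the limit. -/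
theorem InvariantBelow.of_sub_mem {D : FormalConnection n} (hD : D.StartsAtStandard)
    {h h' : FormalFn n} {k : ℕ} (hk : 1 ≤ k) (hP : InvariantBelow ω D k h)
    (hg : h' - h ∈ ord (M := FormalFn n) k) : InvariantBelow ω D k h' := by
  obtain ⟨hh, hP⟩ := hP
  have hh' : h' ∈ ord (M := FormalFn n) 1 := by
    simpa using Submodule.add_mem _ (anti hk hg) hh
  refine ⟨hh', fun i hi a b c => ?_⟩
  have h1 := gaugeConn_sub_mem (ω := ω) hD hh hh' hk hg a b c i (by omega)
  have h2 := fpd_mem_ord a (fpd_mem_ord b (mem_ord_pi.1 (hamiltonian_mem_ord ω hg) c)) i hi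
  rw [map_sub, h2, sub_zero, map_sub, sub_eq_zero] at h1
  rw [h1]
  exact hP i hi a b c

theorem InvariantBelow.exists_succ (hn : 2 ≤ n) {D : FormalConnection n}
    (hstd : D.StartsAtStandard) (hsymp : D.IsSymplectic ω)
    {s : FormalVF n → FormalVF n → FormalFn n} (hs : D.HasRicciShape ω s) {h : FormalFn n} {k : ℕ}
    (hk : 1 ≤ k) (hP : InvariantBelow ω D k h) :
    ∃ h', h' - h ∈ ord (M := FormalFn n) k ∧ InvariantBelow ω D (k + 1) h' := by
  obtain ⟨hh, hc⟩ := id hP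
  obtain ⟨s', hs'⟩ := gaugeConn_hasRicciShape (ω := ω) h hh hs
  obtain ⟨f, hf⟩ := exists_third_derivative_of_order hn
    (gaugeConn_startsAtStandard ω h hh hstd) (gaugeConn_isSymplectic h hh hsymp) hs' hc
  -- With its index lowered, `∂_a ∂_b X_g` is `∂_a ∂_b ∂_d g`; the sign makes it cancel the third
  -- derivative of `f` at order `k`.
  set g : FormalFn n := -PowerSeries.monomial k f with hg
  have hgk : h + g - h ∈ ord (M := FormalFn n) k := by
    rw [add_sub_cancel_left]
    intro i hi
    rw [hg, map_neg, PowerSeries.coeff_monomial, if_neg (by omega), neg_zero]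
  obtain ⟨hh', hc'⟩ := hP.of_sub_mem hstd hk hgk
  refine ⟨h + g, hgk, hh', fun i hi => ?_⟩
  rcases Nat.lt_succ_iff_lt_or_eq.1 hi with hi | rfl
  · exact hc' i hi
  · intro a b c
    have h1 : ∀ c, PowerSeries.coeff i ((gaugeConn ω (h + g) hh' D).coef a b c)
        = PowerSeries.coeff i ((gaugeConn ω h hh D).coef a b c)
          + pd a (pd b (PowerSeries.coeff i (ω.hamiltonian g c))) := by
      intro c
      have h1 := gaugeConn_sub_mem (ω := ω) hstd hh hh' hk hgk a b c i i.lt_succ_self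
      rw [add_sub_cancel_left, map_sub, map_sub, coeff_fpd, coeff_fpd] at h1
      linear_combination h1
    have h2 : ∀ d, ∑ c, ω.mat c d • PowerSeries.coeff i ((gaugeConn ω (h + g) hh' D).coef a b c)
        ∈ (⊥ : Subalgebra ℝ (Fn n)) := by
      intro d
      have h3 : ∑ c, ω.mat c d • pd a (pd b (PowerSeries.coeff i (ω.hamiltonian g c)))
          = -pd a (pd b (pd d f)) := by
        have h4 := coeff_app_frame (ω := ω) (ω.hamiltonian g) d i
        rw [ω.app_hamiltonian_frame, coeff_fpd, hg, map_neg, PowerSeries.coeff_monomial,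
          if_pos rfl] at h4
        have h5 := congrArg (fun x => pdₗ a (pdₗ b x)) h4
        simp only [← pdₗ_apply, map_neg, map_sum, map_smul] at h5 ⊢
        exact h5.symm
      have h6 := hf a b d
      rw [coeff_app_frame] at h6
      simp only [h1, smul_add, Finset.sum_add_distrib, h3]
      rwa [← sub_eq_add_neg]
    -- The lowered coefficients are constant; raising the index with the inverse of `ω` keeps them
    -- so.
    rw [← ω.sum_inv_smul_sum_form
      (fun c => PowerSeries.coeff i ((gaugeConn ω (h + g) hh' D).coef a b c)) c]
    exact Subalgebra.sum_mem _ fun b _ => Subalgebra.smul_mem _ (h2 b) _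

/-- Every formal curve of Ricci type connections is equivalent to an invariant one. -/
theorem exists_gaugeConn_const (hn : 2 ≤ n) {D : FormalConnection n}
    (hstd : D.StartsAtStandard) (hsymp : D.IsSymplectic ω)
    {s : FormalVF n → FormalVF n → FormalFn n} (hs : D.HasRicciShape ω s) :
    ∃ (h : FormalFn n) (hh : h ∈ ord (M := FormalFn n) 1), ∀ i a b c,
      PowerSeries.coeff i ((gaugeConn ω h hh D).coef a b c) ∈ (⊥ : Subalgebra ℝ (Fn n)) := by
  have h0 : InvariantBelow ω D 1 0 := by
    refine ⟨Submodule.zero_mem _, fun i hi a b c => ?_⟩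
    rw [Nat.lt_one_iff.1 hi, gaugeConn_startsAtStandard ω 0 _ hstd a b c]
    exact Subalgebra.zero_mem _
  choose! next hnext1 hnext2 using fun (k : ℕ) (h : FormalFn n)
    (hP : InvariantBelow ω D (k + 1) h) => hP.exists_succ hn hstd hsymp hs (by omega)
  set u : ℕ → FormalFn n := fun k => Nat.rec 0 (fun k h => next k h) k with hu
  have hu1 : ∀ k, u (k + 1) = next k (u k) := fun k => rfl
  have hu2 : ∀ k, InvariantBelow ω D (k + 1) (u k) := by
    intro k
    induction k with
    | zero => exact h0
    | succ k ih => rw [hu1]; exact hnext2 k _ ih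
  -- Truncated subtraction gives `t 0 = 0`, consistent with `u 0 = 0`, so the partial sums telescope
  -- to `u k`.
  set t : ℕ → FormalFn n := fun k => u k - u (k - 1) with ht
  have ht1 : ∀ k, t k ∈ ord (M := FormalFn n) k := by
    intro k
    cases k with
    | zero => exact ord_zero _
    | succ k => exact hnext1 k _ (hu2 k)
  have ht2 : ∀ k, ∑ j ∈ Finset.range (k + 1), t j = u k := by
    intro k
    induction k with
    | zero => simp [ht, hu]
    | succ k ih => rw [Finset.sum_range_succ, ih]; simp [ht]
  have hlim : ∀ k, InvariantBelow ω D (k + 1) (limSum t ht1) := fun k =>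
    (hu2 k).of_sub_mem hstd (by omega) (by rw [← ht2]; exact limSum_sub_mem t ht1 (k + 1))
  obtain ⟨hh, -⟩ := hlim 0
  exact ⟨limSum t ht1, hh, fun i => (hlim i).2 i i.lt_succ_self⟩

end OrderByOrder

/-! ### Flatness when all coefficients are constant -/

section Constant

variable {ω : InvariantSymplecticForm n} {D : FormalConnection n}

/-- Evaluation of functions at the base point of the torus. -/
def evalZero : Fn n →+* ℝ := (Pi.evalRingHom (fun _ : Torus n => ℝ) 0).comp
  (smoothFunctions n).toSubring.subtype

/-- Evaluation of formal curves of functions at the base point of the torus. -/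
def fevalZero : FormalFn n →+* PowerSeries ℝ := PowerSeries.map evalZero

theorem fevalZero_smul (r : ℝ) (f : FormalFn n) : fevalZero (r • f) = r • fevalZero f := by
  ext k
  rw [PowerSeries.coeff_smul, fevalZero, PowerSeries.coeff_map, PowerSeries.coeff_map,
    PowerSeries.coeff_smul]
  rfl

/-- All coefficients are constant functions. -/
def IsConst (D : FormalConnection n) : Prop :=
  ∀ i a b c, PowerSeries.coeff i (D.coef a b c) ∈ (⊥ : Subalgebra ℝ (Fn n))

theorem IsConst.fpd_eq_zero (hc : IsConst D) (a b c d : Fin (2 * n)) : fpd a (D.coef b c d) = 0 := by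
  ext1 k
  obtain ⟨r, hr⟩ := Algebra.mem_bot.1 (hc k b c d)
  rw [coeff_fpd, ← hr, pd_algebraMap, map_zero]

theorem IsConst.eq_map (hc : IsConst D) (a b c : Fin (2 * n)) :
    D.coef a b c = PowerSeries.map (algebraMap ℝ (Fn n)) (fevalZero (D.coef a b c)) := by
  ext1 k
  obtain ⟨r, hr⟩ := Algebra.mem_bot.1 (hc k a b c)
  rw [PowerSeries.coeff_map, fevalZero, PowerSeries.coeff_map, ← hr]
  rfl

/-- Evaluation at one point moves the problem to `ℝ[[t]]`, a domain as the algebraic theorem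
requires. Constant coefficients are recovered from their values, and `s` need not be known constant
since the Ricci shape is a pointwise identity. -/
theorem IsConst.isFlat (hn : 2 ≤ n) (hc : IsConst D) (hsymp : D.IsSymplectic ω)
    {s : FormalVF n → FormalVF n → FormalFn n} (hs : D.HasRicciShape ω s) : D.IsFlat := by
  have hsmul : ∀ (r : ℝ) (p : PowerSeries ℝ), r • p = p * algebraMap ℝ (PowerSeries ℝ) r :=
    fun r p => by rw [Algebra.smul_def, mul_comm]
  set Γ : Fin (2 * n) → Matrix (Fin (2 * n)) (Fin (2 * n)) (PowerSeries ℝ) := fun a =>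
    Matrix.of fun b c => fevalZero (D.coef a b c) with hΓ
  have happ : ∀ (X : FormalVF n) d, fevalZero (ω.app X (frame d))
      = ∑ f, fevalZero (X f) * ω.matMap (PowerSeries ℝ) f d := by
    intro X d
    simp only [ω.app_frame_right, map_sum, fevalZero_smul, hsmul, ω.matMap_apply]
  have hΓW : ∀ a b c, (Γ a * ω.matMap (PowerSeries ℝ)) b c
      = fevalZero (ω.app (D.coef a b) (frame c)) := by
    intro a b c
    rw [happ, Matrix.mul_apply]
    rfl
  have hcomm := ω.commute_of_const hn Γ
    (Matrix.of fun c d => fevalZero (s (frame c) (frame d)))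
    (fun a b c => by
      change fevalZero (D.coef a b c) = fevalZero (D.coef b a c)
      rw [hsymp.coef_symm])
    (fun a => by
      ext1 b c
      rw [Matrix.transpose_apply, hΓW, hΓW, hsymp.app_coef_symm])
    (fun a b => by
      ext1 c d
      have h1 := congrArg fevalZero (hs.frame a b c d)
      rw [happ] at h1
      rw [Matrix.mul_apply, InvariantSymplecticForm.ricciMat_apply]
      have h2 : ∀ f, (Γ b * Γ a - Γ a * Γ b) c f
          = fevalZero (D.curv (frame a) (frame b) (frame c) f) := by
        intro f
        rw [D.curv_frame, hc.fpd_eq_zero, hc.fpd_eq_zero, sub_zero, zero_add, map_sum,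
          Matrix.sub_apply, Matrix.mul_apply, Matrix.mul_apply, ← Finset.sum_sub_distrib]
        simp only [map_sub, map_mul]
        rfl
      refine ((Finset.sum_congr rfl fun f _ => by rw [h2]).trans h1).trans ?_
      simp only [InvariantSymplecticForm.ricciForm, map_add, map_sub, fevalZero_smul]
      simp only [Matrix.of_apply, InvariantSymplecticForm.matMap_apply, Algebra.smul_def,
        map_ofNat]
      ring)
  refine D.isFlat_of_frame fun a b c => funext fun d => ?_
  have h1 := congrFun (congrFun (hcomm a b) c) d
  rw [Matrix.sub_apply, Matrix.mul_apply, Matrix.mul_apply, ← Finset.sum_sub_distrib] at h1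
  have h2 := congrArg (PowerSeries.map (algebraMap ℝ (Fn n))) h1
  rw [D.curv_frame, hc.fpd_eq_zero, hc.fpd_eq_zero, sub_zero, zero_add]
  rw [map_sum] at h2
  simp only [map_sub, map_mul] at h2
  rw [Matrix.zero_apply, map_zero] at h2
  rw [Pi.zero_apply, ← h2]
  refine Finset.sum_congr rfl fun e _ => ?_
  rw [hc.eq_map b c e, hc.eq_map a e d, hc.eq_map a c e, hc.eq_map b e d]
  rfl

end Constant

/-! ### Constant coefficients and translation invariance -/

section Translation

variable {D : FormalConnection n}

/-- Translation as a ring homomorphism on functions. -/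
def translateHom (v : Torus n) : Fn n →+* Fn n where
  toFun := translate v
  map_one' := rfl
  map_mul' _ _ := rfl
  map_zero' := rfl
  map_add' _ _ := rfl

theorem ftranslate_eq_map (v : Torus n) (f : FormalFn n) :
    ftranslate v f = PowerSeries.map (translateHom v) f := by
  ext1 k
  rw [PowerSeries.coeff_map, ftranslate, PowerSeries.coeff_mk]
  rfl

theorem pd_translate (a : Fin (2 * n)) (v : Torus n) (f : Fn n) :
    pd a (translate v f) = translate v (pd a f) := by
  refine Subtype.ext (funext fun x => ?_)
  change deriv (fun s : ℝ => f.1 (x + proj n (Pi.single a s) + v)) 0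
    = deriv (fun s : ℝ => f.1 (x + v + proj n (Pi.single a s))) 0
  simp only [add_right_comm x v]

theorem fpd_ftranslate (a : Fin (2 * n)) (v : Torus n) (f : FormalFn n) :
    fpd a (ftranslate v f) = ftranslate v (fpd a f) := by
  ext1 k
  rw [coeff_fpd, ftranslate, ftranslate, PowerSeries.coeff_mk, PowerSeries.coeff_mk, coeff_fpd,
    pd_translate]

theorem IsConst.isInvariant (hc : IsConst D) : D.IsInvariant := by
  intro v X Y
  funext c
  have h1 : ∀ a b c, D.coef a b c = ftranslate v (D.coef a b c) := by
    intro a b c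
    ext1 k
    obtain ⟨r, hr⟩ := Algebra.mem_bot.1 (hc k a b c)
    rw [ftranslate, PowerSeries.coeff_mk, ← hr]
    rfl
  have h2 : ∀ a b, ftranslate v (X a) * ftranslate v (Y b) * D.coef a b c
      = ftranslate v (X a * Y b * D.coef a b c) := by
    intro a b
    conv_lhs => rw [h1 a b c]
    simp only [ftranslate_eq_map, map_mul]
  simp only [FormalConnection.cov, FormalVF.translate, act, fpd_ftranslate, h2]
  simp only [ftranslate_eq_map, map_add, map_sum, map_mul]

end Translation

/-! ### The Hamiltonian flow as a formal symplectomorphism -/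

section Symplectomorphism

variable {ω : InvariantSymplecticForm n} (h : FormalFn n) (hh : h ∈ ord (M := FormalFn n) 1)

theorem fpd_C_algebraMap (a : Fin (2 * n)) (r : ℝ) :
    fpd a (PowerSeries.C (algebraMap ℝ (Fn n) r)) = 0 := by
  ext1 k
  rw [coeff_fpd, PowerSeries.coeff_C]
  split_ifs
  · rw [pd_algebraMap, map_zero]
  · rw [← pdₗ_apply, map_zero, map_zero]

theorem gaugeFn_eq_self {f : FormalFn n} (hf : ∀ a, fpd a f = 0) : gaugeFn ω h hh f = f :=
  fexp_eq_self (raises_act ω hh) (by rw [actₗ_apply, act]; simp [hf])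

theorem coeff_gaugeFn (f : FormalFn n) :
    PowerSeries.coeff 0 (gaugeFn ω h hh f) = PowerSeries.coeff 0 f := by
  have := fexp_sub_mem (raises_act ω hh) 0 f (ord_zero f) 0 (by omega)
  rwa [map_sub, sub_eq_zero] at this

theorem fpd_C (a : Fin (2 * n)) (f : Fn n) : fpd a (PowerSeries.C f) = PowerSeries.C (pd a f) := by
  ext1 k
  rw [coeff_fpd, PowerSeries.coeff_C, PowerSeries.coeff_C]
  split_ifs
  · rfl
  · rw [← pdₗ_apply, map_zero]

theorem fpoisson_C (f g : Fn n) : ω.fpoisson (PowerSeries.C f) (PowerSeries.C g)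
    = PowerSeries.C (ω.poisson f g) := by
  have hC : ∀ (r : ℝ) (f : Fn n), r • PowerSeries.C f = PowerSeries.C (r • f) := fun r f => by
    ext1 k
    rw [PowerSeries.coeff_smul, PowerSeries.coeff_C, PowerSeries.coeff_C]
    split_ifs <;> simp
  simp only [InvariantSymplecticForm.fpoisson, InvariantSymplecticForm.hamiltonian, act, fpd_C, hC,
    InvariantSymplecticForm.poisson, map_sum, map_mul]

/-- The formal symplectomorphism given by a formal Hamiltonian flow. -/
def gaugeSymplecto (ω : InvariantSymplecticForm n) (h : FormalFn n)
    (hh : h ∈ ord (M := FormalFn n) 1) : FormalSymplecto ω where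
  hom :=
    { toFun := fun f => gaugeFn ω h hh (PowerSeries.C f)
      map_one' := by rw [map_one, gaugeFn_eq_self h hh fpd_one]
      map_mul' := fun f g => by rw [map_mul, gaugeFn_mul]
      map_zero' := by rw [map_zero, map_zero]
      map_add' := fun f g => by rw [map_add, map_add]
      commutes' := fun r => by
        rw [gaugeFn_eq_self h hh fun a => fpd_C_algebraMap a r,
          PowerSeries.algebraMap_apply] }
  map_poisson f g := by
    change gaugeFn ω h hh _ = ω.fpoisson (gaugeFn ω h hh _) (gaugeFn ω h hh _)
    rw [← gaugeFn_fpoisson, fpoisson_C]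
  leading_bijective := by
    have h1 : (fun f : Fn n => PowerSeries.coeff 0 (gaugeFn ω h hh (PowerSeries.C f))) = id :=
      funext fun f => by rw [coeff_gaugeFn, PowerSeries.coeff_zero_C]; rfl
    change Function.Bijective fun f : Fn n => PowerSeries.coeff 0 (gaugeFn ω h hh (PowerSeries.C f))
    rw [h1]
    exact Function.bijective_id

theorem gaugeSymplecto_hom (f : Fn n) :
    (gaugeSymplecto ω h hh).hom f = gaugeFn ω h hh (PowerSeries.C f) := rfl

/-- The flow is multiplicative and fixes `t`, so it agrees with the `ℝ[[t]]`-linear extension on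
polynomials in `t`; it preserves the `t`-adic filtration, so truncating `f` after order `m` does not
affect the coefficient of order `m`. -/
theorem gaugeSymplecto_ext (f : FormalFn n) :
    (gaugeSymplecto ω h hh).ext f = gaugeFn ω h hh f := by
  ext1 m
  have hX : ∀ i, gaugeFn ω h hh (PowerSeries.X ^ i) = PowerSeries.X ^ i := by
    intro i
    induction i with
    | zero => rw [pow_zero, gaugeFn_eq_self h hh fpd_one]
    | succ i ih => rw [pow_succ, gaugeFn_mul, ih, gaugeFn_eq_self h hh fpd_X]
  have h1 : f - ∑ i ∈ Finset.range (m + 1), PowerSeries.C (PowerSeries.coeff i f) * PowerSeries.X ^ i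
      ∈ ord (M := FormalFn n) (m + 1) := by
    intro k hk
    rw [map_sub, map_sum, sub_eq_zero]
    simp only [PowerSeries.coeff_C_mul, PowerSeries.coeff_X_pow, mul_ite, mul_one, mul_zero]
    rw [Finset.sum_ite_eq, if_pos (Finset.mem_range.2 hk)]
  have h2 := fexp_mem (raises_act ω hh) (m + 1) _ h1 m m.lt_succ_self
  change PowerSeries.coeff m (gaugeFn ω h hh _) = 0 at h2
  rw [map_sub, map_sub, sub_eq_zero, map_sum, map_sum] at h2
  rw [h2, FormalSymplecto.ext, PowerSeries.coeff_mk, Finset.Nat.sum_antidiagonal_eq_sum_range_succ_mk]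
  refine Finset.sum_congr rfl fun i hi => ?_
  rw [gaugeFn_mul, hX, gaugeSymplecto_hom, PowerSeries.coeff_mul_X_pow',
    if_pos (Nat.lt_succ_iff.1 (Finset.mem_range.1 hi))]

theorem gaugeSymplecto_push (X : FormalVF n) :
    (gaugeSymplecto ω h hh).Push X (gaugeVF ω h hh X) := fun g => by
  rw [gaugeSymplecto_ext, gaugeSymplecto_ext, gauge_act]

theorem gaugeSymplecto_transforms (D : FormalConnection n) :
    (gaugeSymplecto ω h hh).Transforms D (gaugeConn ω h hh D) := by
  intro X Y
  obtain ⟨X, rfl⟩ := gaugeVF_surjective (ω := ω) h hh X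
  obtain ⟨Y, rfl⟩ := gaugeVF_surjective (ω := ω) h hh Y
  refine ⟨X, Y, gaugeSymplecto_push h hh X, gaugeSymplecto_push h hh Y, ?_⟩
  rw [gaugeConn_cov]
  exact gaugeSymplecto_push h hh _

end Symplectomorphism

end FormalTorus

end

theorem mainTheorem1 (n : ℕ) (hn : 2 ≤ n) (ω : FormalTorus.InvariantSymplecticForm n)
    (D : FormalTorus.FormalConnection n) (hsymp : D.IsSymplectic ω)
    (hstart : D.StartsAtStandard) (hricci : D.IsRicciType ω) :
    (∃ (ψ : FormalTorus.FormalSymplecto ω) (D' : FormalTorus.FormalConnection n),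
      ψ.Transforms D D' ∧ D'.IsSymplectic ω ∧ D'.IsInvariant ∧ D'.IsRicciType ω ∧ D'.IsFlat) ∧
    D.IsFlat := by
  obtain ⟨s, hs⟩ := hricci.hasRicciShape
  obtain ⟨h, hh, hc⟩ := FormalTorus.exists_gaugeConn_const hn hstart hsymp hs
  obtain ⟨s', hs'⟩ := FormalTorus.gaugeConn_hasRicciShape (ω := ω) h hh hs
  have hsymp' := FormalTorus.gaugeConn_isSymplectic h hh hsymp
  have hflat := FormalTorus.IsConst.isFlat hn hc hsymp' hs'
  exact ⟨⟨FormalTorus.gaugeSymplecto ω h hh, FormalTorus.gaugeConn ω h hh D,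
    FormalTorus.gaugeSymplecto_transforms h hh D, hsymp', FormalTorus.IsConst.isInvariant hc,
    hflat.isRicciType ω, hflat⟩, FormalTorus.isFlat_of_gaugeConn h hh hflat⟩
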